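/- Let $q\in\mathbb C$ with $0<|q|<1$. For $k\in\mathbb N=\{0,1,2,\dots\}$ put $(a)_k=\prod_{j=0}^{k-1}(1-aq^j)$ and $(a_1,\dots,a_n)_k=(a_1)_k\cdots(a_n)_k$, and let $${}_{10}W_9[a_0;a_3,\dots,a_9;q;u]=\sum_{k\in\mathbb N}\frac{1-a_0q^{2k}}{1-a_0}\,\frac{(a_0,a_3,\dots,a_9)_k}{(q,a_0q/a_3,\dots,a_0q/a_9)_k}\,u^k .$$ (All series below that enter with a nonzero coefficient terminate, and are read as finite sums.) Let $N\in\mathbb N$ and let $t,b,c,d_1,d_2,e,f,\sigma,\beta,\gamma,\delta_1,\delta_2,\epsilon,\phi$ be nonzero complex numbers that satisfy the balancing condition $$t^3\sigma^3q^{N+4}=bcd_1d_2ef\,\beta\gamma\delta_1\delta_2\epsilon\phi$$ and for which no denominator in the following formula vanishes. Then $$\sum_{K\in\mathbb N}\frac{(b/t,\,c/t,\,d_1/t,\,d_2/t,\,\sigma q,\,\epsilon,\,\phi,\,q^{-N})_K}{(q,\,1/t,\,q/e,\,q/f,\,\sigma q/\beta,\,\sigma q/\gamma,\,\sigma q/\delta_1,\,\sigma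 q/\delta_2)_K}\,q^K$$ $$\times\,{}_{10}W_9\!\left[tq^{-K};b,c,d_1,d_2,eq^{-K},fq^{-K},q^{-K};q;\frac{t^3q^3}{bcd_1d_2ef}\right]$$ $$\times\,{}_{10}W_9\!\left[\sigma q^{K};\beta,\gamma,\delta_1,\delta_2,\epsilon q^{K},\phi q^{K},q^{K-N};q;\frac{\sigma^3q^{N+3}}{\beta\gamma\delta_1\delta_2\epsilon\phi}\right]$$ $$=\phi^N\,\frac{(\sigma q/\delta_1\phi,\,\sigma q/\delta_2\phi,\,\epsilon,\,\sigma q/\gamma\phi,\,\sigma q,\,\sigma q/\beta\phi)_N}{(\sigma q/\delta_1,\,\sigma q/\delta_2,\,\epsilon/\phi,\,\sigma q/\gamma,\,\sigma q/\phi,\,\sigma q/\beta)_N}$$ $$\times\sum_{L\in\mathbb N}\frac{(tq/cf,\,tq/bf,\,tq/d_1f,\,tq/d_2f,\,q^{1-N}\phi/\epsilon,\,q^{-N}\phi/\sigma,\,\phi,\,q^{-N})_L}{(q,\,e/f,\,tq/f,\,q/f,\,q^{-N}\gamma\phi/\sigma,\,q^{-N}\beta\phi/\sigma,\,q^{-N}\delta_1\phi/\sigma,\,q^{-N}\delta_2\phi/\sigma)_L}\,q^L$$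 $$\times\,{}_{10}W_9\!\left[\frac{q^{-L}f}{e};\frac{tq}{ce},\frac{tq}{be},\frac{tq}{d_1e},\frac{tq}{d_2e},\frac{fq^{-L}}{t},fq^{-L},q^{-L};q;\frac{bcd_1d_2ef\,q^{-1}}{t^3}\right]$$ $$\times\,{}_{10}W_9\!\left[\frac{q^{L-N}\phi}{\epsilon};\frac{\sigma q}{\gamma\epsilon},\frac{\sigma q}{\beta\epsilon},\frac{\sigma q}{\delta_1\epsilon},\frac{\sigma q}{\delta_2\epsilon},\frac{q^{-N+L}\phi}{\sigma},q^L\phi,q^{L-N};q;\frac{\beta\gamma\delta_1\delta_2\epsilon\phi\,q^{-N-1}}{\sigma^3}\right].$$ Here $x/yz$ inside a $q$-shifted factorial means $x/(yz)$. -/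

import Mathlib

noncomputable section

/-- The `q`-shifted factorial `(a; q)_k = ∏_{0 ≤ j < k} (1 - a q ^ j)` for a natural number `k`. -/
def qPoch (q a : ℂ) (k : ℕ) : ℂ := ∏ j ∈ Finset.range k, (1 - a * q ^ j)

/-- The product `(a₁, …, aₙ; q)_k = (a₁; q)_k ⋯ (aₙ; q)_k`. -/
def qPochs (q : ℂ) (as : List ℂ) (k : ℕ) : ℂ := (as.map fun a => qPoch q a k).prod

/-- The `k`-th term of the very well-poised series `W[a₀; as; q; u]`. -/
def vwpTerm (q a₀ : ℂ) (as : List ℂ) (u : ℂ) (k : ℕ) : ℂ :=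
  (1 - a₀ * q ^ (2 * k)) / (1 - a₀) *
    (qPochs q (a₀ :: as) k / qPochs q (q :: as.map fun a => a₀ * q / a) k) * u ^ k

/-- The very well-poised basic hypergeometric series `W[a₀; as; q; u]`. If `as` has seven
entries, this is a `₁₀W₉` series. -/
def vwpW (q a₀ : ℂ) (as : List ℂ) (u : ℂ) : ℂ := ∑' k : ℕ, vwpTerm q a₀ as u k

/-- No denominator vanishes in the terms of index `0, …, n` of `W[a₀; as; q; u]`, these being all
the terms of a series that terminates because `q ^ (-n)` is an entry of `as`. (The factors
`(q; q)_k` never vanish for `0 < |q| < 1`.) -/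
def VWPRegular (q a₀ : ℂ) (as : List ℂ) (n : ℕ) : Prop :=
  1 - a₀ ≠ 0 ∧ qPochs q (as.map fun a => a₀ * q / a) n ≠ 0

end

/-! The identity is the coefficient of z^N in a product of two Euler-type transformations whose
infinite products cancel.

After reversal of factorials, each inner ₁₀W₉ series, together with part of its outer factor,
becomes a sum over k₁ + k₂ = n of an A-type summand in the variables x = (1, 1/t)
(`vwpW_eq_sum_pairWeight`). It is embedded in a double sum T(n, m) over |k| = n and |l| = m, in
which l has variables y = (1, 1/t') and dual parameters u/b, u/c, …, and k, l are coupled by the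
factors 1/(u x_i y_j)_{k_i + l_j}. The series on the left correspond to T(n, 0), those on the right
to T(0, n). A residue identity (`kernel_identity`) yields the recurrence (1 - q^(n+1)) T(n+1, m) =
(1 - B q^(n-m)) T(n, m) + B q^(n-m) (1 - q^(m+1)) T(n, m+1) (`doubleSum_rec`). Solved down to n = 0,
it says that up to degree N ∑ T(n, 0) z^n = (Bz)_∞/(z)_∞ ∑ T(0, n) (Bz)^n.

The Greek parameters give a second family U, of the same kind, with constant B'. The balancing
condition is exactly B B' = 1, so in ∑ T(n, 0) z^n · ∑ U(n, 0) (Bz)^n the Euler factors are mutually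
inverse (`sum_antidiagonal_euler`). The remaining work converts the outer factorials and compares
prefactors. -/

theorem qPoch_zero (q a : ℂ) : qPoch q a 0 = 1 := by simp [qPoch]

theorem qPoch_succ (q a : ℂ) (k : ℕ) :
    qPoch q a (k + 1) = qPoch q a k * (1 - a * q ^ k) := by
  simp [qPoch, Finset.prod_range_succ]

theorem one_sub_ne_zero_of_qPoch_ne_zero {q a : ℂ} {n : ℕ} (h : qPoch q a n ≠ 0) {k : ℕ}
    (hk : k < n) : 1 - a * q ^ k ≠ 0 :=
  Finset.prod_ne_zero_iff.mp h k (Finset.mem_range.mpr hk)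

theorem qPoch_ne_zero_of_le {q a : ℂ} {n k : ℕ} (h : qPoch q a n ≠ 0) (hk : k ≤ n) :
    qPoch q a k ≠ 0 :=
  Finset.prod_ne_zero_iff.mpr fun _ hj =>
    one_sub_ne_zero_of_qPoch_ne_zero h ((Finset.mem_range.mp hj).trans_le hk)

theorem one_sub_pow_succ_ne_zero {q : ℂ} (hq1 : ‖q‖ < 1) (k : ℕ) : 1 - q ^ (k + 1) ≠ 0 := by
  intro h
  have h1 : ‖q ^ (k + 1)‖ < 1 := by
    rw [norm_pow]; exact pow_lt_one₀ (norm_nonneg q) hq1 (Nat.succ_ne_zero k)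
  rw [← sub_eq_zero.mp h] at h1
  simp at h1

theorem qPoch_self_ne_zero {q : ℂ} (hq1 : ‖q‖ < 1) (k : ℕ) : qPoch q q k ≠ 0 :=
  Finset.prod_ne_zero_iff.mpr fun j _ => by
    rw [← pow_succ']; exact one_sub_pow_succ_ne_zero hq1 j

theorem qPoch_eq_zero_of_lt {q s : ℂ} {n k : ℕ} (hs : s * q ^ n = 1) (h : n < k) :
    qPoch q s k = 0 :=
  Finset.prod_eq_zero (Finset.mem_range.mpr h) (by rw [hs, sub_self])

theorem one_sub_mul_qPoch_mul (q a : ℂ) (k : ℕ) :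
    (1 - a) * qPoch q (a * q) k = qPoch q a k * (1 - a * q ^ k) := by
  rw [← qPoch_succ]
  simp only [qPoch, Finset.prod_range_succ', pow_zero, mul_one]
  rw [mul_comm]
  congr 1
  exact Finset.prod_congr rfl fun j _ => by ring

/-! ### Reversal of q-shifted factorials -/

/-- The factor that remains when the last `k` factors of `(x; q)_{j + k}` are inverted, up to
`x ^ k`. -/
def reversalFactor (q : ℂ) (j k : ℕ) : ℂ := ∏ i ∈ Finset.range k, (-q ^ (j + i))

theorem reversalFactor_ne_zero {q : ℂ} (hq : q ≠ 0) (j k : ℕ) : reversalFactor q j k ≠ 0 :=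
  Finset.prod_ne_zero_iff.mpr fun _ _ => neg_ne_zero.mpr (pow_ne_zero _ hq)

/-- Each factor is rewritten by 1 - z = -z (1 - 1/z). The hypothesis says that 1/(x q^(j+i)) = y
q^(k-1-i), so the inverted factors are those of (y; q)_k in reverse order. -/
theorem prod_one_sub_eq_reversal {q x y : ℂ} (hq : q ≠ 0) {j k : ℕ}
    (h : y * x * q ^ (j + k) = q) :
    ∏ i ∈ Finset.range k, (1 - x * q ^ (j + i)) =
      qPoch q y k * x ^ k * reversalFactor q j k := by
  rw [qPoch, ← Finset.prod_range_reflect (fun i => 1 - y * q ^ i), reversalFactor, ← Finset.card_range k,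
    ← Finset.prod_const, Finset.card_range, ← Finset.prod_mul_distrib, ← Finset.prod_mul_distrib]
  refine Finset.prod_congr rfl fun i hi => ?_
  have hi := Finset.mem_range.mp hi
  obtain ⟨r, rfl⟩ : ∃ r, k = i + 1 + r := ⟨k - (i + 1), by omega⟩
  have e : i + 1 + r - 1 - i = r := by omega
  have h1 : y * x * q ^ (j + i + r) = 1 := by
    apply mul_right_cancel₀ hq
    linear_combination h
  rw [e]
  linear_combination -h1

theorem qPoch_add_eq_reversal {q x y : ℂ} (hq : q ≠ 0) {j k : ℕ}
    (h : y * x * q ^ (j + k) = q) :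
    qPoch q x (j + k) = qPoch q x j * (qPoch q y k * x ^ k * reversalFactor q j k) := by
  rw [← prod_one_sub_eq_reversal hq h, qPoch, Finset.prod_range_add, qPoch]

/-- Reversal for any solution of the recurrence of 1/(x; q)_m. No division occurs, so it also
applies where (x; q)_m vanishes. -/
theorem eq_reversal_mul {q x y : ℂ} (hq : q ≠ 0) {j k : ℕ} (h : y * x * q ^ (j + k) = q)
    {g : ℕ → ℂ} (hg : ∀ m < j + k, g m = (1 - x * q ^ m) * g (m + 1)) :
    g j = qPoch q y k * x ^ k * reversalFactor q j k * g (j + k) := by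
  rw [← prod_one_sub_eq_reversal hq h]
  clear h
  induction k with
  | zero => simp
  | succ k ih =>
    rw [ih fun m hm => hg m (by omega), Finset.prod_range_succ, hg (j + k) (by omega)]
    ring_nf

/-! ### The two-variable A-type weight and its one-step relations -/

/-- `(1 - b z)(1 - c z)(1 - d₁ z)(1 - d₂ z)`. -/
noncomputable def linProd (b c d₁ d₂ z : ℂ) : ℂ := (1 - b * z) * (1 - c * z) * (1 - d₁ * z) * (1 - d₂ * z)

/-- The summand, without the remaining denominator parameters, of the two-dimensional `A`-type
series in the variables `1` and `1 / t`. -/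
noncomputable def pairWeight (q t b c d₁ d₂ : ℂ) (k : ℕ × ℕ) : ℂ :=
  (q ^ k.1 - q ^ k.2 / t) / (1 - 1 / t) *
    ((qPoch q b k.1 * qPoch q c k.1 * qPoch q d₁ k.1 * qPoch q d₂ k.1) *
      (qPoch q (b / t) k.2 * qPoch q (c / t) k.2 * qPoch q (d₁ / t) k.2 * qPoch q (d₂ / t) k.2)) /
    ((qPoch q q k.1 * qPoch q (t * q) k.1) * (qPoch q q k.2 * qPoch q (q / t) k.2))

/-- The parameter `t` keeps the variables `q ^ i` and `q ^ j / t` apart for `i + j ≤ N`. -/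
def Separated (q t : ℂ) (N : ℕ) : Prop := ∀ i j, i + j ≤ N → t * q ^ i ≠ q ^ j

theorem Separated.sub_ne_zero {q t : ℂ} {N : ℕ} (h : Separated q t N) (ht : t ≠ 0) {i j : ℕ}
    (hij : i + j ≤ N) : q ^ i - q ^ j / t ≠ 0 := by
  intro h0
  apply h i j hij
  field_simp at h0
  linear_combination h0

theorem weight_ratio {D₁ D₂ D₃ D₄ : ℂ} (h₁ : D₁ ≠ 0) (h₂ : D₂ ≠ 0) (h₃ : D₃ ≠ 0) (h₄ : D₄ ≠ 0)
    (C P Q V n : ℂ) :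
    D₁ / C * P / Q * (n * V / D₁) =
      D₂ / C * (P * n) / (Q * (D₃ * D₄)) * (D₃ * D₄ * V / D₂) := by
  field_simp

theorem pairWeight_step_fst {q t : ℂ} (hq1 : ‖q‖ < 1) (ht : t ≠ 0) {N : ℕ}
    (hs : Separated q t N) (b c d₁ d₂ : ℂ) {i j : ℕ} (hij : i + j + 1 ≤ N) :
    pairWeight q t b c d₁ d₂ (i, j) *
        (linProd b c d₁ d₂ (q ^ i) * (q ^ j / t) / (q ^ i - q ^ j / t)) =
      pairWeight q t b c d₁ d₂ (i + 1, j) *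
        ((1 - q ^ (i + 1)) * (1 - t * q ^ (i + 1)) * (q ^ j / t) /
          (q ^ (i + 1) - q ^ j / t)) := by
  have h1 := hs.sub_ne_zero ht (i := i) (j := j) (by omega)
  have h2 := hs.sub_ne_zero ht (i := i + 1) (j := j) (by omega)
  have h3 := one_sub_pow_succ_ne_zero hq1 i
  have h4 : 1 - t * q ^ (i + 1) ≠ 0 := fun h => hs (i + 1) 0 (by omega) (by
    rw [pow_zero]; linear_combination -h)
  simp only [pairWeight, linProd, qPoch_succ]
  rw [show q * q ^ i = q ^ (i + 1) by ring, show t * q * q ^ i = t * q ^ (i + 1) by ring]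
  convert weight_ratio h1 h2 h3 h4 _ _ _ _ _ using 3
  · ring
  · ring

theorem pairWeight_step_snd {q t : ℂ} (hq1 : ‖q‖ < 1) (ht : t ≠ 0) {N : ℕ}
    (hs : Separated q t N) (b c d₁ d₂ : ℂ) {i j : ℕ} (hij : i + j + 1 ≤ N) :
    pairWeight q t b c d₁ d₂ (i, j) *
        (linProd b c d₁ d₂ (q ^ j / t) * q ^ i / (q ^ j / t - q ^ i)) =
      pairWeight q t b c d₁ d₂ (i, j + 1) *
        ((1 - q ^ (j + 1)) * (1 - q ^ (j + 1) / t) * q ^ i /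
          (q ^ (j + 1) / t - q ^ i)) := by
  have h1 := hs.sub_ne_zero ht (i := i) (j := j) (by omega)
  have h2 := hs.sub_ne_zero ht (i := i) (j := j + 1) (by omega)
  have h3 := one_sub_pow_succ_ne_zero hq1 j
  have h4 : 1 - q ^ (j + 1) / t ≠ 0 := by
    simpa using hs.sub_ne_zero ht (i := 0) (j := j + 1) (by omega)
  simp only [pairWeight, linProd, qPoch_succ]
  rw [show q * q ^ j = q ^ (j + 1) by ring, show q / t * q ^ j = q ^ (j + 1) / t by ring,
    ← neg_sub (q ^ i), ← neg_sub (q ^ i) (q ^ (j + 1) / t), div_neg, div_neg, mul_neg, mul_neg,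
    neg_inj]
  convert weight_ratio h1 h2 h3 h4 _ _ _ _ _ using 3
  · ring
  · ring

/-- The two first-order steps, summed against an arbitrary function. -/
theorem sum_pairWeight_step {q t : ℂ} (hq1 : ‖q‖ < 1) (ht : t ≠ 0) {N : ℕ}
    (hs : Separated q t N) (b c d₁ d₂ : ℂ) {n : ℕ} (hn : n + 1 ≤ N) (g : ℕ → ℕ → ℂ) :
    ∑ k ∈ Finset.HasAntidiagonal.antidiagonal n, pairWeight q t b c d₁ d₂ k *
        (linProd b c d₁ d₂ (q ^ k.1) * (q ^ k.2 / t) / (q ^ k.1 - q ^ k.2 / t) *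
            g (k.1 + 1) k.2 +
          linProd b c d₁ d₂ (q ^ k.2 / t) * q ^ k.1 / (q ^ k.2 / t - q ^ k.1) *
            g k.1 (k.2 + 1)) =
      (q ^ (n + 1) - 1) *
        ∑ k ∈ Finset.HasAntidiagonal.antidiagonal (n + 1), pairWeight q t b c d₁ d₂ k * g k.1 k.2 := by
  have hX : ∀ k ∈ Finset.HasAntidiagonal.antidiagonal (n + 1),
      (q ^ (n + 1) - 1) * (pairWeight q t b c d₁ d₂ k * g k.1 k.2) =
      pairWeight q t b c d₁ d₂ k * ((1 - q ^ k.1) * (1 - t * q ^ k.1) * (q ^ k.2 / t) /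
          (q ^ k.1 - q ^ k.2 / t)) * g k.1 k.2 +
      pairWeight q t b c d₁ d₂ k * ((1 - q ^ k.2) * (1 - q ^ k.2 / t) * q ^ k.1 /
          (q ^ k.2 / t - q ^ k.1)) * g k.1 k.2 := by
    rintro ⟨i, j⟩ hk
    have hk : i + j = n + 1 := by simpa using hk
    have h1 := hs.sub_ne_zero ht (i := i) (j := j) (by omega)
    -- Partial fractions split q^(n+1) - 1 into one term per variable. The factors 1 - q^i and 1 -
    -- q^j kill the boundary terms, so each part can be shifted down by one index.
    have h : q ^ (n + 1) - 1 = (1 - q ^ i) * (1 - t * q ^ i) * (q ^ j / t) / (q ^ i - q ^ j / t) +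
        (1 - q ^ j) * (1 - q ^ j / t) * q ^ i / (q ^ j / t - q ^ i) := by
      rw [← neg_sub (q ^ i) (q ^ j / t), div_neg, ← sub_eq_add_neg, ← sub_div, eq_div_iff h1,
        ← hk, pow_add]
      field_simp
      ring
    simp only [h]
    ring
  rw [Finset.mul_sum, Finset.sum_congr rfl hX, Finset.sum_add_distrib,
    Finset.Nat.sum_antidiagonal_succ, Finset.Nat.sum_antidiagonal_succ',
    ← add_assoc]
  simp only [pow_zero, sub_self, zero_mul, mul_zero, zero_div, zero_add, add_zero]
  rw [← Finset.sum_add_distrib]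
  refine Finset.sum_congr rfl fun k hk => ?_
  have hk : k.1 + k.2 = n := by simpa using hk
  rw [← pairWeight_step_fst hq1 ht hs b c d₁ d₂ (by omega),
    ← pairWeight_step_snd hq1 ht hs b c d₁ d₂ (by omega)]
  ring

/-! ### The interpolating double sum and its recurrence -/

/-- Sum of the residues of `linProd b c d₁ d₂ z` / (z (z - Z₁)(z - Z₂)(1 - u V₁ z)(1 - u V₂ z)),
with denominators cleared. The poles Z₁, Z₂ give the left side, 0 the term -1, infinity the constant
before it, and the poles 1/(u V_j) the dual products. -/
theorem kernel_identity {b c d₁ d₂ u Z₁ Z₂ V₁ V₂ : ℂ} (hb : b ≠ 0) (hc : c ≠ 0) (hd₁ : d₁ ≠ 0)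
    (hd₂ : d₂ ≠ 0) (hu : u ≠ 0) (hV₁ : V₁ ≠ 0) (hV₂ : V₂ ≠ 0)
    (hZ : Z₁ - Z₂ ≠ 0) (hV : V₁ - V₂ ≠ 0) :
    linProd b c d₁ d₂ Z₁ * Z₂ / (Z₁ - Z₂) * ((1 - u * Z₂ * V₁) * (1 - u * Z₂ * V₂)) +
        linProd b c d₁ d₂ Z₂ * Z₁ / (Z₂ - Z₁) * ((1 - u * Z₁ * V₁) * (1 - u * Z₁ * V₂)) =
      (b * c * d₁ * d₂ * Z₁ * Z₂ / (u ^ 2 * V₁ * V₂) - 1) *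
          ((1 - u * Z₁ * V₁) * (1 - u * Z₁ * V₂) * (1 - u * Z₂ * V₁) * (1 - u * Z₂ * V₂)) +
        b * c * d₁ * d₂ * Z₁ * Z₂ / (u ^ 2 * V₁ * V₂) *
          (linProd (u / b) (u / c) (u / d₁) (u / d₂) V₁ * V₂ / (V₁ - V₂) *
              ((1 - u * Z₁ * V₂) * (1 - u * Z₂ * V₂)) +
            linProd (u / b) (u / c) (u / d₁) (u / d₂) V₂ * V₁ / (V₂ - V₁) *
              ((1 - u * Z₁ * V₁) * (1 - u * Z₂ * V₁))) := by
  simp only [linProd]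
  rw [← neg_sub Z₁ Z₂, ← neg_sub V₁ V₂]
  field_simp
  ring

/-- The sequence `h` satisfies the recurrence of `1 / (x; q)_m` for indices below `N`. -/
def InvShifts (q x : ℂ) (N : ℕ) (h : ℕ → ℂ) : Prop :=
  ∀ m < N, h m = (1 - x * q ^ m) * h (m + 1)

theorem invShifts_one_div_qPoch {q x : ℂ} {N : ℕ} (h : qPoch q x N ≠ 0) :
    InvShifts q x N fun m => 1 / qPoch q x m := by
  intro m hm
  have h1 := one_sub_ne_zero_of_qPoch_ne_zero h hm
  simp only [qPoch_succ]
  rw [mul_one_div, mul_comm (qPoch q x m), ← div_div, div_self h1]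

/-- The double `A`-type sum over `k` and `l` with `|k| = n` and `|l| = m`; it interpolates between
the two sides of the transformation. -/
noncomputable def doubleSum (q t t' u b c d₁ d₂ : ℂ) (h₁₁ h₁₂ h₂₁ h₂₂ : ℕ → ℂ) (n m : ℕ) : ℂ :=
  ∑ k ∈ Finset.HasAntidiagonal.antidiagonal n, ∑ l ∈ Finset.HasAntidiagonal.antidiagonal m,
    pairWeight q t b c d₁ d₂ k * pairWeight q t' (u / b) (u / c) (u / d₁) (u / d₂) l *
      (h₁₁ (k.1 + l.1) * h₁₂ (k.1 + l.2) * h₂₁ (k.2 + l.1) * h₂₂ (k.2 + l.2))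

/-- Raising n and raising m are both pulled back to sums over |k| = n and |l| = m by
`sum_pairWeight_step`. There the relation holds term by term: it is the kernel identity at Z_i = x_i
q^(k_i), V_j = y_j q^(l_j). -/
theorem doubleSum_rec {q t t' u b c d₁ d₂ : ℂ} (hq0 : q ≠ 0) (hq1 : ‖q‖ < 1) (ht : t ≠ 0)
    (ht' : t' ≠ 0) (hu : u ≠ 0) (hb : b ≠ 0) (hc : c ≠ 0) (hd₁ : d₁ ≠ 0) (hd₂ : d₂ ≠ 0) {N : ℕ}
    (hs : Separated q t N) (hs' : Separated q t' N) {h₁₁ h₁₂ h₂₁ h₂₂ : ℕ → ℂ}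
    (H₁₁ : InvShifts q u N h₁₁) (H₁₂ : InvShifts q (u / t') N h₁₂)
    (H₂₁ : InvShifts q (u / t) N h₂₁) (H₂₂ : InvShifts q (u / (t * t')) N h₂₂)
    {n m : ℕ} (hnm : n + m + 1 ≤ N) {B : ℂ} (hB : B = b * c * d₁ * d₂ * t' / (t * u ^ 2)) :
    (1 - q ^ (n + 1)) * doubleSum q t t' u b c d₁ d₂ h₁₁ h₁₂ h₂₁ h₂₂ (n + 1) m =
      (1 - B * q ^ n / q ^ m) * doubleSum q t t' u b c d₁ d₂ h₁₁ h₁₂ h₂₁ h₂₂ n m +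
        B * q ^ n / q ^ m *
          ((1 - q ^ (m + 1)) * doubleSum q t t' u b c d₁ d₂ h₁₁ h₁₂ h₂₁ h₂₂ n (m + 1)) := by
  set w := pairWeight q t b c d₁ d₂ with hw
  set w' := pairWeight q t' (u / b) (u / c) (u / d₁) (u / d₂) with hw'
  let G : ℕ → ℕ → ℕ → ℕ → ℂ := fun k₁ k₂ l₁ l₂ =>
    h₁₁ (k₁ + l₁) * h₁₂ (k₁ + l₂) * h₂₁ (k₂ + l₁) * h₂₂ (k₂ + l₂)
  have L1 : ∀ l : ℕ × ℕ, (1 - q ^ (n + 1)) *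
      ∑ k ∈ Finset.HasAntidiagonal.antidiagonal (n + 1), w k * G k.1 k.2 l.1 l.2 = _ := fun l => by
    rw [← neg_sub, neg_mul, ← sum_pairWeight_step hq1 ht hs b c d₁ d₂ (by omega)
      fun k₁ k₂ => G k₁ k₂ l.1 l.2]
  have L2 : ∀ k : ℕ × ℕ, (1 - q ^ (m + 1)) *
      ∑ l ∈ Finset.HasAntidiagonal.antidiagonal (m + 1), w' l * G k.1 k.2 l.1 l.2 = _ := fun k => by
    rw [← neg_sub, neg_mul, ← sum_pairWeight_step hq1 ht' hs' (u / b) (u / c) (u / d₁) (u / d₂)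
      (by omega) fun l₁ l₂ => G k.1 k.2 l₁ l₂]
  have E1 : (1 - q ^ (n + 1)) * doubleSum q t t' u b c d₁ d₂ h₁₁ h₁₂ h₂₁ h₂₂ (n + 1) m =
      ∑ l ∈ Finset.HasAntidiagonal.antidiagonal m, w' l * ((1 - q ^ (n + 1)) *
        ∑ k ∈ Finset.HasAntidiagonal.antidiagonal (n + 1), w k * G k.1 k.2 l.1 l.2) := by
    rw [doubleSum, Finset.sum_comm, Finset.mul_sum]
    refine Finset.sum_congr rfl fun l _ => ?_
    rw [mul_left_comm, Finset.mul_sum (a := w' l)]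
    congr 1
    exact Finset.sum_congr rfl fun k _ => by simp only [G]; ring
  have E2 : (1 - q ^ (m + 1)) * doubleSum q t t' u b c d₁ d₂ h₁₁ h₁₂ h₂₁ h₂₂ n (m + 1) =
      ∑ k ∈ Finset.HasAntidiagonal.antidiagonal n, w k * ((1 - q ^ (m + 1)) *
        ∑ l ∈ Finset.HasAntidiagonal.antidiagonal (m + 1), w' l * G k.1 k.2 l.1 l.2) := by
    rw [doubleSum, Finset.mul_sum]
    refine Finset.sum_congr rfl fun k _ => ?_
    rw [mul_left_comm, Finset.mul_sum (a := w k)]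
    congr 1
    exact Finset.sum_congr rfl fun l _ => by simp only [G]; ring
  rw [E1, E2]
  simp only [L1, L2, Finset.mul_sum, mul_neg, ← Finset.sum_neg_distrib, doubleSum]
  rw [Finset.sum_comm, ← Finset.sum_add_distrib]
  refine Finset.sum_congr rfl fun k hk => ?_
  rw [← Finset.sum_add_distrib]
  refine Finset.sum_congr rfl fun l hl => ?_
  obtain ⟨k₁, k₂⟩ := k
  obtain ⟨l₁, l₂⟩ := l
  have hk : k₁ + k₂ = n := by simpa using hk
  have hl : l₁ + l₂ = m := by simpa using hl
  have K := kernel_identity (Z₁ := q ^ k₁) (Z₂ := q ^ k₂ / t) (V₁ := q ^ l₁) (V₂ := q ^ l₂ / t')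
    hb hc hd₁ hd₂ hu (pow_ne_zero _ hq0) (div_ne_zero (pow_ne_zero _ hq0) ht')
    (hs.sub_ne_zero ht (by omega)) (hs'.sub_ne_zero ht' (by omega))
  have hβ : b * c * d₁ * d₂ * q ^ k₁ * (q ^ k₂ / t) / (u ^ 2 * q ^ l₁ * (q ^ l₂ / t')) =
      B * q ^ n / q ^ m := by
    rw [hB, ← hk, ← hl, pow_add, pow_add]
    field_simp
  rw [hβ] at K
  -- Writing every coupling factor at its raised index leaves a common product times the polynomials
  -- of the kernel identity.
  have g₁₁ := H₁₁ (k₁ + l₁) (by omega)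
  have g₁₂ := H₁₂ (k₁ + l₂) (by omega)
  have g₂₁ := H₂₁ (k₂ + l₁) (by omega)
  have g₂₂ := H₂₂ (k₂ + l₂) (by omega)
  rw [show u * q ^ (k₁ + l₁) = u * q ^ k₁ * q ^ l₁ by rw [pow_add]; ring] at g₁₁
  rw [show u / t' * q ^ (k₁ + l₂) = u * q ^ k₁ * (q ^ l₂ / t') by rw [pow_add]; ring] at g₁₂
  rw [show u / t * q ^ (k₂ + l₁) = u * (q ^ k₂ / t) * q ^ l₁ by rw [pow_add]; ring] at g₂₁
  rw [show u / (t * t') * q ^ (k₂ + l₂) = u * (q ^ k₂ / t) * (q ^ l₂ / t') by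
    rw [pow_add]; field_simp] at g₂₂
  simp only [G, add_right_comm _ 1, ← add_assoc]
  rw [g₁₁, g₁₂, g₂₁, g₂₂]
  linear_combination (-(w (k₁, k₂) * w' (l₁, l₂) * h₁₁ (k₁ + l₁ + 1) * h₁₂ (k₁ + l₂ + 1) *
    h₂₁ (k₂ + l₁ + 1) * h₂₂ (k₂ + l₂ + 1))) * K

/-! ### Solving the recurrence -/

/-- The coefficients of `(β)_i β ^ j / ((q)_i (q)_j)`. -/
noncomputable def eulerCoeff (q β : ℂ) (i j : ℕ) : ℂ :=
  qPoch q β i * β ^ j / (qPoch q q i * qPoch q q j)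

theorem qPoch_succ_div {q : ℂ} (hq : q ≠ 0) (β : ℂ) (i : ℕ) :
    qPoch q (β / q) (i + 1) = (1 - β / q) * qPoch q β i := by
  have h := one_sub_mul_qPoch_mul q (β / q) i
  rw [div_mul_cancel₀ _ hq] at h
  rw [h, qPoch_succ]

/-- The recurrence of the double sum, for its proposed solution: with β = B/q^m, raising m by one
replaces β by β/q and shifts g. -/
theorem sum_eulerCoeff_succ {q : ℂ} (hq0 : q ≠ 0) (hq1 : ‖q‖ < 1) (β : ℂ) (n : ℕ) (g : ℕ → ℂ) :
    (1 - q ^ (n + 1)) *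
        ∑ k ∈ Finset.HasAntidiagonal.antidiagonal (n + 1), eulerCoeff q β k.1 k.2 * g k.2 =
      (1 - β * q ^ n) *
          ∑ k ∈ Finset.HasAntidiagonal.antidiagonal n, eulerCoeff q β k.1 k.2 * g k.2 +
        β * q ^ n *
          ∑ k ∈ Finset.HasAntidiagonal.antidiagonal n,
            eulerCoeff q (β / q) k.1 k.2 * g (k.2 + 1) := by
  let X : ℕ × ℕ → ℂ := fun k => match k with
    | (0, _) => 0
    | (i + 1, j) => (1 - β * q ^ n) * eulerCoeff q β i j * g j
  let Y : ℕ × ℕ → ℂ := fun k => match k with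
    | (_, 0) => 0
    | (i, j + 1) => β * q ^ n * eulerCoeff q (β / q) i j * g (j + 1)
  have hXY : ∀ k ∈ Finset.HasAntidiagonal.antidiagonal (n + 1),
      (1 - q ^ (n + 1)) * (eulerCoeff q β k.1 k.2 * g k.2) = X k + Y k := by
    rintro ⟨i, j⟩ hk
    have hk : i + j = n + 1 := by simpa using hk
    have ei : ∀ i, qPoch q q (i + 1) = qPoch q q i * (1 - q ^ (i + 1)) := fun i => by
      rw [qPoch_succ, ← pow_succ']
    cases i with
    | zero =>
      cases j with
      | zero => omega
      | succ j =>
        obtain rfl : j = n := by omega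
        have h1 := one_sub_pow_succ_ne_zero hq1 j
        have h2 := qPoch_self_ne_zero hq1 j
        simp only [X, Y, eulerCoeff, qPoch_zero, ei, div_pow]
        generalize 1 - q ^ (j + 1) = D at *
        field_simp
        ring
    | succ i =>
      have h1 := one_sub_pow_succ_ne_zero hq1 i
      have h2 := qPoch_self_ne_zero hq1 i
      cases j with
      | zero =>
        obtain rfl : i = n := by omega
        simp only [X, Y, eulerCoeff, qPoch_zero, ei, qPoch_succ q β]
        generalize 1 - q ^ (i + 1) = D at *
        field_simp
        ring
      | succ j =>
        obtain rfl : n = i + j + 1 := by omega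
        have h3 := one_sub_pow_succ_ne_zero hq1 j
        have h4 := qPoch_self_ne_zero hq1 j
        simp only [X, Y, eulerCoeff, qPoch_succ_div hq0, ei, qPoch_succ q β]
        have key : (1 - q ^ (i + j + 1 + 1)) * (1 - β * q ^ i) =
            (1 - β * q ^ (i + j + 1)) * (1 - q ^ (i + 1)) +
              (1 - β / q) * q ^ (i + 1) * (1 - q ^ (j + 1)) := by
          field_simp
          ring
        have e : β * q ^ (i + j + 1) * (β / q) ^ j = q ^ (i + 1) * β ^ (j + 1) := by
          rw [div_pow]; field_simp; ring
        generalize 1 - q ^ (i + 1) = D at *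
        generalize 1 - q ^ (j + 1) = D' at *
        generalize qPoch q β i = R at *
        generalize qPoch q q i = Q at *
        generalize qPoch q q j = Q' at *
        trans R * β ^ (j + 1) * g (j + 1) / (Q * D * (Q' * D')) *
          ((1 - q ^ (i + j + 1 + 1)) * (1 - β * q ^ i))
        · ring
        rw [key, mul_add]
        congr 1
        · field_simp
        · trans β * q ^ (i + j + 1) * (β / q) ^ j * ((1 - β / q) * R / (Q * D * Q') * g (j + 1))
          · rw [e]
            generalize 1 - β / q = S
            field_simp
          · ring
  rw [Finset.mul_sum, Finset.sum_congr rfl hXY, Finset.sum_add_distrib,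
    Finset.Nat.sum_antidiagonal_succ, Finset.Nat.sum_antidiagonal_succ' (f := Y)]
  simp only [X, Y, zero_add, Finset.mul_sum, mul_assoc]

theorem doubleSum_zero_right {q t t' u b c d₁ d₂ : ℂ} (hq0 : q ≠ 0) (hq1 : ‖q‖ < 1) (ht : t ≠ 0)
    (ht' : t' ≠ 0) (hu : u ≠ 0) (hb : b ≠ 0) (hc : c ≠ 0) (hd₁ : d₁ ≠ 0) (hd₂ : d₂ ≠ 0) {N : ℕ}
    (hs : Separated q t N) (hs' : Separated q t' N) {h₁₁ h₁₂ h₂₁ h₂₂ : ℕ → ℂ}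
    (H₁₁ : InvShifts q u N h₁₁) (H₁₂ : InvShifts q (u / t') N h₁₂)
    (H₂₁ : InvShifts q (u / t) N h₂₁) (H₂₂ : InvShifts q (u / (t * t')) N h₂₂)
    {n : ℕ} (hn : n ≤ N) {B : ℂ} (hB : B = b * c * d₁ * d₂ * t' / (t * u ^ 2)) :
    doubleSum q t t' u b c d₁ d₂ h₁₁ h₁₂ h₂₁ h₂₂ n 0 =
      ∑ k ∈ Finset.HasAntidiagonal.antidiagonal n, qPoch q B k.1 / qPoch q q k.1 *
        (B ^ k.2 * doubleSum q t t' u b c d₁ d₂ h₁₁ h₁₂ h₂₁ h₂₂ 0 k.2) := by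
  set T := doubleSum q t t' u b c d₁ d₂ h₁₁ h₁₂ h₂₁ h₂₂ with hT
  -- The induction on n needs all m at once. The weight (q; q)_m absorbs the factor 1 - q^(m+1) of
  -- the recurrence.
  have main : ∀ n m, n + m ≤ N → qPoch q q m * T n m =
      ∑ k ∈ Finset.HasAntidiagonal.antidiagonal n, eulerCoeff q (B / q ^ m) k.1 k.2 *
        (qPoch q q (k.2 + m) * T 0 (k.2 + m)) := by
    intro n
    induction n with
    | zero => intro m _; simp [eulerCoeff, qPoch_zero]
    | succ n ih =>
      intro m hm
      apply mul_left_cancel₀ (one_sub_pow_succ_ne_zero hq1 n)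
      rw [sum_eulerCoeff_succ hq0 hq1 _ _ fun j => qPoch q q (j + m) * T 0 (j + m),
        ← ih m (by omega)]
      have h2 := ih (m + 1) (by omega)
      rw [show B / q ^ (m + 1) = B / q ^ m / q by rw [pow_succ, div_div]] at h2
      simp only [add_assoc, add_comm 1 m]
      rw [← h2, qPoch_succ, ← pow_succ']
      have h3 := doubleSum_rec hq0 hq1 ht ht' hu hb hc hd₁ hd₂ hs hs' H₁₁ H₁₂ H₂₁ H₂₂
        (n := n) (m := m) (by omega) hB
      rw [← hT] at h3
      linear_combination qPoch q q m * h3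
  have h := main n 0 (by omega)
  rw [qPoch_zero, one_mul, pow_zero, div_one] at h
  rw [h]
  refine Finset.sum_congr rfl fun k _ => ?_
  have h1 := qPoch_self_ne_zero hq1 k.2
  simp only [eulerCoeff, add_zero]
  rw [mul_comm (qPoch q q k.1), ← div_div, div_mul_eq_mul_div, div_mul_eq_mul_div,
    div_mul_eq_mul_div, div_div]
  rw [div_eq_div_iff (mul_ne_zero h1 (qPoch_self_ne_zero hq1 _)) (qPoch_self_ne_zero hq1 _)]
  ring

/-! ### Cancellation of the Euler factors -/

open PowerSeries in
/-- `(B u)_∞ / (u)_∞` and `(u)_∞ / (B u)_∞` are inverse to each other. -/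
theorem euler_series_mul {q B : ℂ} (hq1 : ‖q‖ < 1) (hB : B ≠ 0) :
    (PowerSeries.mk fun i => qPoch q B i / qPoch q q i) *
      (PowerSeries.mk fun j => qPoch q (1 / B) j / qPoch q q j * B ^ j) = 1 := by
  set P : PowerSeries ℂ := PowerSeries.mk fun i => qPoch q B i / qPoch q q i with hP
  set Q : PowerSeries ℂ := PowerSeries.mk fun j => qPoch q (1 / B) j / qPoch q q j * B ^ j with hQ
  have eP : (1 - X) * P = (1 - C B * X) * rescale q P := by
    ext n
    cases n with
    | zero =>
      simp only [sub_mul, one_mul, map_sub, coeff_zero_X_mul, mul_assoc, coeff_C_mul,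
        coeff_rescale, pow_zero, mul_zero]
    | succ n =>
      have h1 := one_sub_pow_succ_ne_zero hq1 n
      have h2 := qPoch_self_ne_zero hq1 n
      simp only [sub_mul, one_mul, map_sub, coeff_succ_X_mul, mul_assoc, coeff_C_mul,
        coeff_rescale, hP, coeff_mk, qPoch_succ, ← pow_succ']
      generalize hD : 1 - q ^ (n + 1) = D at *
      rw [show q ^ (n + 1) = 1 - D by rw [← hD]; ring]
      field_simp
      ring
  have eQ : (1 - C B * X) * Q = (1 - X) * rescale q Q := by
    ext n
    cases n with
    | zero =>
      simp only [sub_mul, one_mul, map_sub, coeff_zero_X_mul, mul_assoc, coeff_C_mul,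
        coeff_rescale, pow_zero, mul_zero]
    | succ n =>
      have h1 := one_sub_pow_succ_ne_zero hq1 n
      have h2 := qPoch_self_ne_zero hq1 n
      simp only [sub_mul, one_mul, map_sub, coeff_succ_X_mul, mul_assoc, coeff_C_mul,
        coeff_rescale, hQ, coeff_mk, qPoch_succ, ← pow_succ']
      generalize hD : 1 - q ^ (n + 1) = D at *
      rw [show q ^ (n + 1) = 1 - D by rw [← hD]; ring]
      field_simp
      ring
  have h0 : ((1 - X) * (1 - C B * X) : PowerSeries ℂ) ≠ 0 := by
    intro h
    have := congrArg constantCoeff h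
    simp at this
  -- The two q-difference equations make the product invariant under z ↦ qz. Since q^n ≠ 1 for n >
  -- 0, only the constant coefficient survives.
  have e : P * Q = rescale q (P * Q) := by
    apply mul_left_cancel₀ h0
    rw [map_mul]
    linear_combination (1 - C B * X) * Q * eP + (1 - C B * X) * rescale q P * eQ
  ext n
  cases n with
  | zero => simp [hP, hQ, qPoch_zero]
  | succ n =>
    have := congrArg (coeff (n + 1)) e
    rw [coeff_rescale] at this
    rw [coeff_one, if_neg (Nat.succ_ne_zero n)]
    apply (mul_eq_zero.mp (_ : (1 - q ^ (n + 1)) * _ = 0)).resolve_left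
      (one_sub_pow_succ_ne_zero hq1 n)
    linear_combination this

/-- The weight B^n on `G` rescales its variable so that its Euler factor becomes the inverse of that
of `F`. -/
theorem sum_antidiagonal_euler {q B : ℂ} (hq1 : ‖q‖ < 1) (hB : B ≠ 0) {N : ℕ}
    {F G F' G' : ℕ → ℂ}
    (hF : ∀ n ≤ N, F n = ∑ k ∈ Finset.HasAntidiagonal.antidiagonal n,
      qPoch q B k.1 / qPoch q q k.1 * (B ^ k.2 * F' k.2))
    (hG : ∀ n ≤ N, G n = ∑ k ∈ Finset.HasAntidiagonal.antidiagonal n,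
      qPoch q (1 / B) k.1 / qPoch q q k.1 * ((1 / B) ^ k.2 * G' k.2)) :
    ∑ k ∈ Finset.HasAntidiagonal.antidiagonal N, F k.1 * (B ^ k.2 * G k.2) =
      ∑ k ∈ Finset.HasAntidiagonal.antidiagonal N, B ^ k.1 * F' k.1 * G' k.2 := by
  set P : PowerSeries ℂ := PowerSeries.mk fun i => qPoch q B i / qPoch q q i with hP
  set Q : PowerSeries ℂ := PowerSeries.mk fun j => qPoch q (1 / B) j / qPoch q q j * B ^ j with hQ
  set F₁ : PowerSeries ℂ := PowerSeries.mk fun n => B ^ n * F' n with hF₁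
  set G₁ : PowerSeries ℂ := PowerSeries.mk fun n => G' n with hG₁
  have e1 : ∀ n ≤ N, F n = PowerSeries.coeff n (P * F₁) := fun n hn => by
    simp [hF n hn, PowerSeries.coeff_mul, hP, hF₁]
  have e2 : ∀ n ≤ N, B ^ n * G n = PowerSeries.coeff n (Q * G₁) := fun n hn => by
    rw [hG n hn, PowerSeries.coeff_mul, Finset.mul_sum]
    refine Finset.sum_congr rfl fun k hk => ?_
    have hk : k.1 + k.2 = n := by simpa using hk
    rw [← hk, hQ, hG₁, PowerSeries.coeff_mk, PowerSeries.coeff_mk, pow_add, one_div, inv_pow]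
    have := pow_ne_zero k.2 hB
    field_simp
  calc _ = PowerSeries.coeff N ((P * F₁) * (Q * G₁)) := by
        rw [PowerSeries.coeff_mul]
        refine Finset.sum_congr rfl fun k hk => ?_
        have hk : k.1 + k.2 = N := by simpa using hk
        rw [e1 _ (by omega), e2 _ (by omega)]
    _ = PowerSeries.coeff N (F₁ * G₁) := by
        rw [mul_mul_mul_comm, euler_series_mul hq1 hB, one_mul]
    _ = _ := by simp [PowerSeries.coeff_mul, hF₁, hG₁]

/-! ### From very well-poised series to two-variable sums -/

theorem qPochs_nil (q : ℂ) (k : ℕ) : qPochs q [] k = 1 := by simp [qPochs]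

theorem qPochs_cons (q a : ℂ) (as : List ℂ) (k : ℕ) :
    qPochs q (a :: as) k = qPoch q a k * qPochs q as k := by simp [qPochs]

theorem qPochs_ne_zero_iff {q : ℂ} {as : List ℂ} {k : ℕ} :
    qPochs q as k ≠ 0 ↔ ∀ a ∈ as, qPoch q a k ≠ 0 := by
  simp [qPochs, List.prod_eq_zero_iff]

theorem qPochs_eq_zero {q : ℂ} {as : List ℂ} {k : ℕ} {a : ℂ} (ha : a ∈ as)
    (h : qPoch q a k = 0) : qPochs q as k = 0 := by
  by_contra h'
  exact qPochs_ne_zero_iff.mp h' a ha h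

theorem vwpW_eq_sum {q : ℂ} (a₀ : ℂ) {as : List ℂ} (u : ℂ) {n : ℕ} {s : ℂ}
    (hs : s * q ^ n = 1) (h : s ∈ as) :
    vwpW q a₀ as u = ∑ k ∈ Finset.range (n + 1), vwpTerm q a₀ as u k := by
  refine tsum_eq_sum fun k hk => ?_
  have hk : n < k := by simpa using hk
  rw [vwpTerm, qPochs_eq_zero (List.mem_cons_of_mem _ h) (qPoch_eq_zero_of_lt hs hk)]
  simp

/-- The algebra of `vwpTerm_pairWeight` with factorials and powers as free letters. Only letters
that really cancel are assumed nonzero; the other denominators stay as inverses. -/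
theorem reversal_assembly {Yb Yc Yd Yd' te tf tq E xb xc xd xd' xt xe xf qk Tj ts Ej es Qj s Qk
    C D Qt Δ w v : ℂ} (hYb : Yb ≠ 0) (hYc : Yc ≠ 0) (hYd : Yd ≠ 0) (hYd' : Yd' ≠ 0) (hE : E ≠ 0)
    (hxt : xt ≠ 0) (hxe : xe ≠ 0) (hqk : qk ≠ 0) (hts : ts ≠ 0) (hes : es ≠ 0) (hs : s ≠ 0)
    (hD : D ≠ 0) (hΔ : -Qt * Δ = w * qk) (hv : xb * xc * xd * xd' * v * qk = qk * xt * xe * xf)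
    {Pb Pc Pd Pd' Bk Ck Dk Dk' fs h₀ : ℂ} :
    Pb * (Yb * xb * E) * (Pc * (Yc * xc * E) * (Pd * (Yd * xd * E) * (Pd' * (Yd' * xd' * E)))) /
          (Qj * (s * qk * E)) * (-D * Qt / (C * (Tj * (ts * xt * E)))) / (Ej * (es * xe * E)) *
        h₀ *
        (Δ / D * (ts * (Bk * (Ck * (Dk * (Dk' * (es * (fs * s)))))) /
          (Qk * (Yb * (Yc * (Yd * (Yd' * (te * (tf * tq)))))))) * v) =
      w / C * (Bk * Ck * Dk * Dk' * (Pb * Pc * Pd * Pd')) / (Qk * tq * (Qj * Tj)) *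
        (1 / te * (1 / tf) * (1 / Ej) * (fs * xf * E * h₀)) := by
  have hv' : xb * xc * xd * xd' * v * xt⁻¹ * xe⁻¹ = xf := by
    field_simp
    apply mul_left_cancel₀ hqk
    linear_combination hv
  have hw : -Qt * Δ * qk⁻¹ = w := by rw [hΔ]; field_simp
  rw [← hw, ← hv']
  trans (Yb * Yb⁻¹) * (Yc * Yc⁻¹) * (Yd * Yd⁻¹) * (Yd' * Yd'⁻¹) * (s * s⁻¹) * (ts * ts⁻¹) *
    (es * es⁻¹) * (D * D⁻¹) * (E * E⁻¹) ^ 3 * ((-Qt * Δ * qk⁻¹) *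
      (xb * xc * xd * xd' * v * xt⁻¹ * xe⁻¹) * C⁻¹ * Bk * Ck * Dk * Dk' * Pb * Pc * Pd * Pd' *
      Qk⁻¹ * tq⁻¹ * Qj⁻¹ * Tj⁻¹ * te⁻¹ * tf⁻¹ * Ej⁻¹ * fs * E * h₀)
  · ring
  · rw [mul_inv_cancel₀ hYb, mul_inv_cancel₀ hYc, mul_inv_cancel₀ hYd, mul_inv_cancel₀ hYd',
      mul_inv_cancel₀ hs, mul_inv_cancel₀ hts, mul_inv_cancel₀ hes, mul_inv_cancel₀ hD,
      mul_inv_cancel₀ hE]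
    ring

/-- With s = q^(-K) and K = j + k, reversing the last k factors of each outer factorial cancels the
factorials of the series that depend on K; what remains separates into functions of k and of j. -/
theorem vwpTerm_pairWeight {q t b c d₁ d₂ e f : ℂ} (hq0 : q ≠ 0) (hq1 : ‖q‖ < 1) (ht : t ≠ 0)
    (hb : b ≠ 0) (hc : c ≠ 0) (hd₁ : d₁ ≠ 0) (hd₂ : d₂ ≠ 0) (he : e ≠ 0) (hf : f ≠ 0) {k j : ℕ}
    {s : ℂ} (hs : s * q ^ (j + k) = 1)
    {h : ℕ → ℂ} (hh : InvShifts q (q / f) (j + k) h) (ht₁ : qPoch q (1 / t) (j + k) ≠ 0)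
    (he₁ : qPoch q (q / e) (j + k) ≠ 0)
    (hW : VWPRegular q (t * s) [b, c, d₁, d₂, e * s, f * s, s] (j + k)) :
    qPochs q [b / t, c / t, d₁ / t, d₂ / t] (j + k) / qPochs q [q, 1 / t, q / e] (j + k) *
        h (j + k) *
        vwpTerm q (t * s) [b, c, d₁, d₂, e * s, f * s, s]
          (t ^ 3 * q ^ 3 / (b * c * d₁ * d₂ * e * f)) k =
      pairWeight q t b c d₁ d₂ (k, j) *
        (1 / qPoch q (t * q / e) k * (1 / qPoch q (t * q / f) k) * (1 / qPoch q (q / e) j) *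
          h j) := by
  have hs0 : s ≠ 0 := by rintro rfl; simp at hs
  obtain ⟨h1, h2⟩ := hW
  have r1 : t * s * q / (e * s) = t * q / e := by field_simp
  have r2 : t * s * q / (f * s) = t * q / f := by field_simp
  have r3 : t * s * q / s = t * q := by field_simp
  simp only [List.map_cons, List.map_nil, r1, r2, r3] at h2
  simp only [vwpTerm, List.map_cons, List.map_nil, r1, r2, r3, qPochs_cons, qPochs_nil, mul_one]
  rw [qPochs_ne_zero_iff] at h2
  simp only [List.mem_cons, List.not_mem_nil, or_false, forall_eq_or_imp, forall_eq] at h2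
  obtain ⟨nb, nc, nd₁, nd₂, -⟩ := h2
  have le : k ≤ j + k := Nat.le_add_left k j
  replace nb := qPoch_ne_zero_of_le nb le
  replace nc := qPoch_ne_zero_of_le nc le
  replace nd₁ := qPoch_ne_zero_of_le nd₁ le
  replace nd₂ := qPoch_ne_zero_of_le nd₂ le
  have nE := reversalFactor_ne_zero hq0 j k
  have R : ∀ p, p ≠ 0 → t * s * q / p * (p / t) * q ^ (j + k) = q := fun p hp => by
    rw [show t * s * q / p * (p / t) * q ^ (j + k) = s * q ^ (j + k) * q by field_simp, hs, one_mul]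
  have Rb := qPoch_add_eq_reversal hq0 (R b hb)
  have Rc := qPoch_add_eq_reversal hq0 (R c hc)
  have Rd₁ := qPoch_add_eq_reversal hq0 (R d₁ hd₁)
  have Rd₂ := qPoch_add_eq_reversal hq0 (R d₂ hd₂)
  have S : ∀ p, p ≠ 0 → p * s * (q / p) * q ^ (j + k) = q := fun p hp => by
    rw [show p * s * (q / p) * q ^ (j + k) = s * q ^ (j + k) * q by field_simp, hs, one_mul]
  have Re := qPoch_add_eq_reversal hq0 (S e he)
  have Rt := qPoch_add_eq_reversal hq0 (S t ht)
  have Rq := qPoch_add_eq_reversal (x := q) (y := s) hq0 (j := j) (k := k) (by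
    linear_combination q * hs)
  have Rf := eq_reversal_mul hq0 (S f hf) hh
  have ht2 := one_sub_mul_qPoch_mul q (1 / t) (j + k)
  rw [one_div_mul_eq_div] at ht2
  have hs1 : 1 - 1 / t * q ^ (j + k) = -(1 - t * s) * (q ^ (j + k) / t) := by
    field_simp
    linear_combination -t * hs
  have ht3 : qPoch q (q / t) (j + k) ≠ 0 := by
    intro h0
    rw [h0, mul_zero, hs1] at ht2
    exact mul_ne_zero ht₁ (mul_ne_zero (neg_ne_zero.mpr h1)
      (div_ne_zero (pow_ne_zero _ hq0) ht)) ht2.symm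
  have hq2 := qPoch_self_ne_zero hq1 (j + k)
  -- The argument of the series is the one for which all k-th powers produced by reversal cancel.
  have hv : (b / t) ^ k * (c / t) ^ k * (d₁ / t) ^ k * (d₂ / t) ^ k *
      (t ^ 3 * q ^ 3 / (b * c * d₁ * d₂ * e * f)) ^ k * q ^ k =
      q ^ k * (q / t) ^ k * (q / e) ^ k * (q / f) ^ k := by
    simp only [← mul_pow]
    congr 1
    field_simp
  have ht4 : 1 / qPoch q (1 / t) (j + k) =
      -(1 - t * s) * (q ^ (j + k) / t) / ((1 - 1 / t) * qPoch q (q / t) (j + k)) := by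
    rw [ht2, hs1]
    rw [one_div, eq_div_iff, inv_mul_cancel_left₀ ht₁]
    exact mul_ne_zero ht₁ (mul_ne_zero (neg_ne_zero.mpr h1)
      (div_ne_zero (pow_ne_zero _ hq0) ht))
  -- The very well-poised factor turns into the Vandermonde factor of the weight.
  have hΔ : -(q ^ (j + k) / t) * (1 - t * s * q ^ (2 * k)) = (q ^ k - q ^ j / t) * q ^ k := by
    field_simp
    linear_combination (t * q ^ (2 * k)) * hs
  have Rt2 := right_ne_zero_of_mul (Rt ▸ ht3)
  have Re2 := right_ne_zero_of_mul (Re ▸ he₁)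
  have Rq2 := right_ne_zero_of_mul (Rq ▸ hq2)
  replace Rt2 := left_ne_zero_of_mul (left_ne_zero_of_mul Rt2)
  replace Re2 := left_ne_zero_of_mul (left_ne_zero_of_mul Re2)
  replace Rq2 := left_ne_zero_of_mul (left_ne_zero_of_mul Rq2)
  rw [Rt] at ht4
  simp only [pairWeight]
  rw [Rf, Rb, Rc, Rd₁, Rd₂, Re, Rq]
  rw [show ∀ x y z w : ℂ, x / (y * (z * w)) = x / y * (1 / z) / w from fun x y z w => by
    rw [← div_div, ← div_div, div_div x y z, ← div_div, ← div_eq_mul_one_div], ht4]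
  exact reversal_assembly nb nc nd₁ nd₂ nE (pow_ne_zero k (div_ne_zero hq0 ht))
    (pow_ne_zero k (div_ne_zero hq0 he)) (pow_ne_zero k hq0) Rt2 Re2 Rq2 h1 hΔ hv

theorem InvShifts.mono {q x : ℂ} {N n : ℕ} {h : ℕ → ℂ} (H : InvShifts q x N h) (hn : n ≤ N) :
    InvShifts q x n h := fun m hm => H m (hm.trans_le hn)

theorem vwpW_eq_sum_pairWeight {q t b c d₁ d₂ e f : ℂ} (hq0 : q ≠ 0) (hq1 : ‖q‖ < 1)
    (ht : t ≠ 0) (hb : b ≠ 0) (hc : c ≠ 0) (hd₁ : d₁ ≠ 0) (hd₂ : d₂ ≠ 0) (he : e ≠ 0)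
    (hf : f ≠ 0) {K : ℕ} {s : ℂ} (hs : s * q ^ K = 1) {h : ℕ → ℂ}
    (hh : InvShifts q (q / f) K h) (ht₁ : qPoch q (1 / t) K ≠ 0) (he₁ : qPoch q (q / e) K ≠ 0)
    (hW : VWPRegular q (t * s) [b, c, d₁, d₂, e * s, f * s, s] K) :
    qPochs q [b / t, c / t, d₁ / t, d₂ / t] K / qPochs q [q, 1 / t, q / e] K * h K *
        vwpW q (t * s) [b, c, d₁, d₂, e * s, f * s, s]
          (t ^ 3 * q ^ 3 / (b * c * d₁ * d₂ * e * f)) =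
      ∑ k ∈ Finset.HasAntidiagonal.antidiagonal K, pairWeight q t b c d₁ d₂ k *
        (1 / qPoch q (t * q / e) k.1 * (1 / qPoch q (t * q / f) k.1) *
          (1 / qPoch q (q / e) k.2) * h k.2) := by
  rw [vwpW_eq_sum _ _ hs (by simp), Finset.Nat.sum_antidiagonal_eq_sum_range_succ_mk,
    Finset.mul_sum]
  refine Finset.sum_congr rfl fun k hk => ?_
  obtain ⟨j, rfl⟩ : ∃ j, K = j + k := ⟨K - k, by have := Finset.mem_range.mp hk; omega⟩
  rw [Nat.add_sub_cancel]
  exact vwpTerm_pairWeight hq0 hq1 ht hb hc hd₁ hd₂ he hf hs hh ht₁ he₁ hW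

theorem pairWeight_zero {q t : ℂ} (ht : 1 - 1 / t ≠ 0) (b c d₁ d₂ : ℂ) :
    pairWeight q t b c d₁ d₂ (0, 0) = 1 := by
  simp only [pairWeight, qPoch_zero, pow_zero, mul_one, div_one]
  exact div_self ht

theorem pairWeight_swap (q t b c d₁ d₂ : ℂ) (k : ℕ × ℕ) :
    pairWeight q t b c d₁ d₂ k = pairWeight q t c b d₁ d₂ k := by
  unfold pairWeight; ring

/-! ### The Euler transformation for ₁₀W₉ series -/

/-- The double sum with denominator parameters `t q / e` and `t q / f`, where `h` stands for
`1 / (q / f; q)_m`. -/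
noncomputable def eulerSum (q t b c d₁ d₂ e f : ℂ) (h : ℕ → ℂ) (n m : ℕ) : ℂ :=
  doubleSum q t (f / e) (t * q / e) b c d₁ d₂ (fun i => 1 / qPoch q (t * q / e) i)
    (fun i => 1 / qPoch q (t * q / f) i) (fun i => 1 / qPoch q (q / e) i) h n m

theorem eulerSum_zero_right {q t e f : ℂ} (hef : 1 - e / f ≠ 0) (b c d₁ d₂ : ℂ) (h : ℕ → ℂ)
    (n : ℕ) : eulerSum q t b c d₁ d₂ e f h n 0 =
      ∑ k ∈ Finset.HasAntidiagonal.antidiagonal n, pairWeight q t b c d₁ d₂ k *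
        (1 / qPoch q (t * q / e) k.1 * (1 / qPoch q (t * q / f) k.1) *
          (1 / qPoch q (q / e) k.2) * h k.2) := by
  rw [← one_div_div] at hef
  simp [eulerSum, doubleSum, pairWeight_zero hef]

theorem eulerSum_zero_left {q t : ℂ} (ht : 1 - 1 / t ≠ 0) (b c d₁ d₂ e f : ℂ) (h : ℕ → ℂ)
    (m : ℕ) : eulerSum q t b c d₁ d₂ e f h 0 m =
      ∑ l ∈ Finset.HasAntidiagonal.antidiagonal m,
        pairWeight q (f / e) (t * q / e / b) (t * q / e / c) (t * q / e / d₁) (t * q / e / d₂) l *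
        (1 / qPoch q (t * q / e) l.1 * (1 / qPoch q (t * q / f) l.2) *
          (1 / qPoch q (q / e) l.1) * h l.2) := by
  simp [eulerSum, doubleSum, pairWeight_zero ht]

theorem separated_of_ne {q t : ℂ} {N : ℕ} (hq : q ≠ 0) (h1 : ∀ K ≤ N, t ≠ q ^ K)
    (h2 : qPoch q (t * q) N ≠ 0) : Separated q t N := by
  intro i j hij h
  rcases lt_or_ge j i with hji | hji
  · obtain ⟨r, rfl⟩ : ∃ r, i = j + (r + 1) := ⟨i - j - 1, by omega⟩
    refine one_sub_ne_zero_of_qPoch_ne_zero h2 (k := r) (by omega) ?_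
    apply mul_left_cancel₀ (pow_ne_zero j hq)
    rw [pow_add] at h
    linear_combination -h
  · obtain ⟨r, rfl⟩ : ∃ r, j = i + r := ⟨j - i, by omega⟩
    refine h1 r (by omega) ?_
    apply mul_left_cancel₀ (pow_ne_zero i hq)
    rw [pow_add] at h
    linear_combination h

theorem eulerSum_transformation {q t b c d₁ d₂ e f : ℂ} (hq0 : q ≠ 0) (hq1 : ‖q‖ < 1)
    (ht : t ≠ 0) (hb : b ≠ 0) (hc : c ≠ 0) (hd₁ : d₁ ≠ 0) (hd₂ : d₂ ≠ 0) (he : e ≠ 0)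
    (hf : f ≠ 0) {N : ℕ} (hs : Separated q t N) (hs' : Separated q (f / e) N)
    (h₁₁ : qPoch q (t * q / e) N ≠ 0) (h₁₂ : qPoch q (t * q / f) N ≠ 0)
    (h₂₁ : qPoch q (q / e) N ≠ 0) {h : ℕ → ℂ} (h₂₂ : InvShifts q (q / f) N h) {n : ℕ}
    (hn : n ≤ N) {B : ℂ} (hB : B = b * c * d₁ * d₂ * e * f / (t ^ 3 * q ^ 2)) :
    eulerSum q t b c d₁ d₂ e f h n 0 =
      ∑ k ∈ Finset.HasAntidiagonal.antidiagonal n, qPoch q B k.1 / qPoch q q k.1 *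
        (B ^ k.2 * eulerSum q t b c d₁ d₂ e f h 0 k.2) := by
  have r₁₂ : t * q / e / (f / e) = t * q / f := by field_simp
  have r₂₁ : t * q / e / t = q / e := by field_simp
  have r₂₂ : t * q / e / (t * (f / e)) = q / f := by field_simp
  refine doubleSum_zero_right hq0 hq1 ht (div_ne_zero hf he) (div_ne_zero (mul_ne_zero ht hq0) he)
    hb hc hd₁ hd₂ hs hs' (invShifts_one_div_qPoch h₁₁) ?_ ?_ ?_ hn ?_
  · rw [r₁₂]; exact invShifts_one_div_qPoch h₁₂
  · rw [r₂₁]; exact invShifts_one_div_qPoch h₂₁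
  · rwa [r₂₂]
  · rw [hB]; field_simp

theorem left_series_eq {q t b c d₁ d₂ e f : ℂ} (hq0 : q ≠ 0) (hq1 : ‖q‖ < 1)
    (ht : t ≠ 0) (hb : b ≠ 0) (hc : c ≠ 0) (hd₁ : d₁ ≠ 0) (hd₂ : d₂ ≠ 0) (he : e ≠ 0)
    (hf : f ≠ 0) {K : ℕ} {s : ℂ} (hs : s * q ^ K = 1) {h : ℕ → ℂ}
    (hh : InvShifts q (q / f) K h) (ht₁ : qPoch q (1 / t) K ≠ 0) (he₁ : qPoch q (q / e) K ≠ 0)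
    (hW : VWPRegular q (t * s) [b, c, d₁, d₂, e * s, f * s, s] K)
    (hef : 1 - e / f ≠ 0) :
    qPochs q [b / t, c / t, d₁ / t, d₂ / t] K / qPochs q [q, 1 / t, q / e] K * h K *
        vwpW q (t * s) [b, c, d₁, d₂, e * s, f * s, s]
          (t ^ 3 * q ^ 3 / (b * c * d₁ * d₂ * e * f)) =
      eulerSum q t b c d₁ d₂ e f h K 0 := by
  rw [eulerSum_zero_right hef,
    vwpW_eq_sum_pairWeight hq0 hq1 ht hb hc hd₁ hd₂ he hf hs hh ht₁ he₁ hW]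

/-- The dual sum has the same shape as the original under t ↦ f/e, e ↦ f/t, f ↦ f, p ↦ tq/(pe) for p
= b, c, d₁, d₂, so `vwpW_eq_sum_pairWeight` applies again, up to the order of the first two
parameters. -/
theorem right_series_eq {q t b c d₁ d₂ e f : ℂ} (hq0 : q ≠ 0) (hq1 : ‖q‖ < 1)
    (ht : t ≠ 0) (hb : b ≠ 0) (hc : c ≠ 0) (hd₁ : d₁ ≠ 0) (hd₂ : d₂ ≠ 0) (he : e ≠ 0)
    (hf : f ≠ 0) {L : ℕ} {s : ℂ} (hs : s * q ^ L = 1) {h : ℕ → ℂ}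
    (hh : InvShifts q (q / f) L h) (hef₁ : qPoch q (e / f) L ≠ 0)
    (hf₁ : qPoch q (t * q / f) L ≠ 0)
    (hW : VWPRegular q (s * f / e) [t * q / (c * e), t * q / (b * e), t * q / (d₁ * e),
      t * q / (d₂ * e), f * s / t, f * s, s] L) (ht0 : 1 - 1 / t ≠ 0) :
    qPochs q [t * q / (c * f), t * q / (b * f), t * q / (d₁ * f), t * q / (d₂ * f)] L /
          qPochs q [q, e / f, t * q / f] L * h L *
        vwpW q (s * f / e) [t * q / (c * e), t * q / (b * e), t * q / (d₁ * e),
          t * q / (d₂ * e), f * s / t, f * s, s]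
          (b * c * d₁ * d₂ * e * f * q ^ (-1 : ℤ) / t ^ 3) =
      eulerSum q t b c d₁ d₂ e f h 0 L := by
  have hp : ∀ p, p ≠ 0 → t * q / (p * e) ≠ 0 := fun p hp =>
    div_ne_zero (mul_ne_zero ht hq0) (mul_ne_zero hp he)
  have e1 : s * f / e = f / e * s := by ring
  have e2 : f * s / t = f / t * s := by ring
  have e3 : e / f = 1 / (f / e) := (one_div_div f e).symm
  have e4 : t * q / f = q / (f / t) := by field_simp
  have e5 : ∀ p, t * q / (p * f) = t * q / (p * e) / (f / e) := fun p => by field_simp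
  have e6 : b * c * d₁ * d₂ * e * f * q ^ (-1 : ℤ) / t ^ 3 =
      (f / e) ^ 3 * q ^ 3 / (t * q / (c * e) * (t * q / (b * e)) * (t * q / (d₁ * e)) *
        (t * q / (d₂ * e)) * (f / t) * f) := by
    rw [zpow_neg_one]; field_simp
  rw [e3] at hef₁
  rw [e4] at hf₁
  rw [e1, e2] at hW
  have key := vwpW_eq_sum_pairWeight hq0 hq1 (div_ne_zero hf he) (hp c hc) (hp b hb) (hp d₁ hd₁)
    (hp d₂ hd₂) (div_ne_zero hf ht) hf hs hh hef₁ hf₁ hW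
  rw [eulerSum_zero_left ht0, e1, e2, e6, e3, e4]
  simp only [e5]
  rw [key]
  refine Finset.sum_congr rfl fun l _ => ?_
  rw [pairWeight_swap, show f / e * q / (f / t) = t * q / e by field_simp,
    show f / e * q / f = q / e by field_simp]
  simp only [div_div, mul_comm e]
  ring

/-! ### Reversal of the outer factorials -/

/-- A nowhere singular multiple of `1 / (q ^ (1 - N) / φ; q)_m`. -/
noncomputable def revPoch (q φ : ℂ) (N m : ℕ) : ℂ :=
  qPoch q φ (N - m) * φ ^ m * reversalFactor q (N - m) m

theorem invShifts_revPoch {q φ : ℂ} (hq : q ≠ 0) (hφ : φ ≠ 0) (N : ℕ) :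
    InvShifts q (q / (φ * q ^ N)) N (revPoch q φ N) := by
  intro m hm
  obtain ⟨r, rfl⟩ : ∃ r, N = m + 1 + r := ⟨N - (m + 1), by omega⟩
  rw [revPoch, revPoch, show m + 1 + r - m = r + 1 by omega, Nat.add_sub_cancel_left,
    qPoch_succ, reversalFactor, reversalFactor, Finset.prod_range_succ']
  have e : ∏ i ∈ Finset.range m, -q ^ (r + 1 + i) = ∏ i ∈ Finset.range m, -q ^ (r + (i + 1)) :=
    Finset.prod_congr rfl fun i _ => by ring
  rw [e, add_zero]
  have e2 : (1 - φ * q ^ r) = (1 - q / (φ * q ^ (m + 1 + r)) * q ^ m) * (φ * -q ^ r) := by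
    field_simp
    ring
  rw [e2]
  ring

/-- Passes from the summation index j to k = N - j, the index of the second family. The factorial of
φ is not reversed but absorbed in `revPoch`, so φ may be a power of 1/q. -/
theorem qPochs_reversal {q φ s A₁ A₂ P₁ P₂ P₃ P₄ A₁' A₂' P₁' P₂' P₃' P₄' : ℂ} (hq0 : q ≠ 0)
    (hq1 : ‖q‖ < 1) (hφ : φ ≠ 0) {j k N : ℕ} (hN : j + k = N) (hs : s * q ^ N = 1)
    (hA₁ : A₁' * A₁ * q ^ N = q) (hA₂ : A₂' * A₂ * q ^ N = q)
    (hP₁ : P₁' * P₁ * q ^ N = q) (hP₂ : P₂' * P₂ * q ^ N = q)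
    (hP₃ : P₃' * P₃ * q ^ N = q) (hP₄ : P₄' * P₄ * q ^ N = q)
    (nA₁ : qPoch q A₁' k ≠ 0) (nA₂ : qPoch q A₂' k ≠ 0)
    (nP : qPochs q [P₁, P₂, P₃, P₄] N ≠ 0) :
    qPochs q [A₁, A₂, φ, s] j / qPochs q [P₁, P₂, P₃, P₄] j =
      qPochs q [A₁, A₂, s] N / qPochs q [P₁, P₂, P₃, P₄] N *
        (P₁ * P₂ * P₃ * P₄ / (A₁ * A₂ * φ * s)) ^ k *
        (qPochs q [P₁', P₂', P₃', P₄'] k / qPochs q [q, A₁', A₂'] k * revPoch q φ N k) := by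
  subst hN
  have nE := reversalFactor_ne_zero hq0 j k
  have nq := qPoch_self_ne_zero hq1 k
  have z : ∀ {x y : ℂ}, y * x * q ^ (j + k) = q → x ^ k ≠ 0 := fun {x y} h => pow_ne_zero k <| by
    rintro rfl
    apply hq0
    rw [← h]; ring
  have ns : s ^ k ≠ 0 := pow_ne_zero k <| by rintro rfl; simp at hs
  have nφ := pow_ne_zero k hφ
  have n1 := z hA₁
  have n2 := z hA₂
  have m1 := z hP₁
  have m2 := z hP₂
  have m3 := z hP₃
  have m4 := z hP₄
  simp only [qPochs_cons, qPochs_nil, mul_one, revPoch, Nat.add_sub_cancel] at nP ⊢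
  rw [qPoch_add_eq_reversal hq0 hA₁, qPoch_add_eq_reversal hq0 hA₂,
    qPoch_add_eq_reversal (y := q) (x := s) hq0 (by linear_combination q * hs)]
  rw [qPoch_add_eq_reversal hq0 hP₁, qPoch_add_eq_reversal hq0 hP₂,
    qPoch_add_eq_reversal hq0 hP₃, qPoch_add_eq_reversal hq0 hP₄] at nP ⊢
  simp only [mul_ne_zero_iff] at nP
  obtain ⟨⟨a1, ⟨b1, -⟩, -⟩, ⟨a2, ⟨b2, -⟩, -⟩, ⟨a3, ⟨b3, -⟩, -⟩, a4, ⟨b4, -⟩, -⟩ := nP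
  simp only [div_pow, mul_pow]
  generalize P₁ ^ k = x1 at *
  generalize P₂ ^ k = x2 at *
  generalize P₃ ^ k = x3 at *
  generalize P₄ ^ k = x4 at *
  generalize A₁ ^ k = x5 at *
  generalize A₂ ^ k = x6 at *
  generalize s ^ k = x7 at *
  generalize φ ^ k = x8 at *
  generalize qPoch q P₁ j = y1 at *
  generalize qPoch q P₂ j = y2 at *
  generalize qPoch q P₃ j = y3 at *
  generalize qPoch q P₄ j = y4 at *
  generalize qPoch q P₁' k = w1 at *
  generalize qPoch q P₂' k = w2 at *
  generalize qPoch q P₃' k = w3 at *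
  generalize qPoch q P₄' k = w4 at *
  generalize qPoch q A₁' k = w5 at *
  generalize qPoch q A₂' k = w6 at *
  generalize qPoch q q k = w7 at *
  generalize reversalFactor q j k = E at *
  field_simp

theorem tsum_eq_sum_antidiagonal {g : ℕ → ℂ} {N : ℕ} (h : ∀ k, N < k → g k = 0) :
    ∑' k, g k = ∑ k ∈ Finset.HasAntidiagonal.antidiagonal N, g k.1 := by
  rw [Finset.Nat.sum_antidiagonal_eq_sum_range_succ_mk]
  exact tsum_eq_sum fun k hk => h k (by simpa using hk)

theorem ne_pow_of_one_sub_ne_zero {q t : ℂ} (hq : q ≠ 0) {K : ℕ}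
    (h : 1 - t * q ^ (-(K : ℤ)) ≠ 0) : t ≠ q ^ K := by
  rintro rfl
  rw [zpow_neg, zpow_natCast, mul_inv_cancel₀ (pow_ne_zero K hq), sub_self] at h
  exact h rfl

theorem one_sub_one_div_ne_zero {t : ℂ} (h : t ≠ 1) : 1 - 1 / t ≠ 0 := by
  rw [sub_ne_zero, ne_comm, one_div]
  exact fun h' => h (inv_eq_one.mp h')

theorem qPoch_eq_full_reversal {q x y : ℂ} (hq : q ≠ 0) {N : ℕ} (h : y * x * q ^ N = q) :
    qPoch q x N = qPoch q y N * x ^ N * reversalFactor q 0 N := by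
  have := qPoch_add_eq_reversal hq (j := 0) (k := N) (by rwa [zero_add])
  rwa [zero_add, qPoch_zero, one_mul] at this

theorem reversalFactor_zero_sq (q : ℂ) (N : ℕ) :
    reversalFactor q 0 N ^ 2 * q ^ N = (q ^ N) ^ N := by
  induction N with
  | zero => simp [reversalFactor]
  | succ n ih =>
    rw [reversalFactor, Finset.prod_range_succ, ← reversalFactor, zero_add]
    trans (reversalFactor q 0 n ^ 2 * q ^ n) * q ^ n * q ^ n * q
    · ring
    · rw [ih]; ring

/-! ### The transformation formula -/

theorem mainTheorem3 (q : ℂ) (hq0 : 0 < ‖q‖) (hq1 : ‖q‖ < 1) (N : ℕ)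
    (t b c d₁ d₂ e f σ β γ δ₁ δ₂ ε φ : ℂ) (ht : t ≠ 0) (hσ : σ ≠ 0)
    -- the totally balancing condition (it makes all the other parameters nonzero, too)
    (hbal : t ^ 3 * σ ^ 3 * q ^ (N + 4) = b * c * d₁ * d₂ * e * f * (β * γ * δ₁ * δ₂ * ε * φ))
    -- no denominator of the formula vanishes
    (hL : qPochs q [1 / t, q / e, q / f, σ * q / β, σ * q / γ, σ * q / δ₁, σ * q / δ₂] N ≠ 0)
    (hL₁ : ∀ K ≤ N, VWPRegular q (t * q ^ (-(K : ℤ)))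
      [b, c, d₁, d₂, e * q ^ (-(K : ℤ)), f * q ^ (-(K : ℤ)), q ^ (-(K : ℤ))] K)
    (hL₂ : ∀ K ≤ N, VWPRegular q (σ * q ^ K)
      [β, γ, δ₁, δ₂, ε * q ^ K, φ * q ^ K, q ^ ((K : ℤ) - N)] (N - K))
    (hP : qPochs q [σ * q / δ₁, σ * q / δ₂, ε / φ, σ * q / γ, σ * q / φ, σ * q / β] N ≠ 0)
    (hR : qPochs q [e / f, t * q / f, q / f, q ^ (-(N : ℤ)) * γ * φ / σ,
      q ^ (-(N : ℤ)) * β * φ / σ, q ^ (-(N : ℤ)) * δ₁ * φ / σ,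
      q ^ (-(N : ℤ)) * δ₂ * φ / σ] N ≠ 0)
    (hR₁ : ∀ L ≤ N, VWPRegular q (q ^ (-(L : ℤ)) * f / e)
      [t * q / (c * e), t * q / (b * e), t * q / (d₁ * e), t * q / (d₂ * e),
        f * q ^ (-(L : ℤ)) / t, f * q ^ (-(L : ℤ)), q ^ (-(L : ℤ))] L)
    (hR₂ : ∀ L ≤ N, VWPRegular q (q ^ ((L : ℤ) - N) * φ / ε)
      [σ * q / (γ * ε), σ * q / (β * ε), σ * q / (δ₁ * ε), σ * q / (δ₂ * ε),
        q ^ (-(N : ℤ) + L) * φ / σ, q ^ L * φ, q ^ ((L : ℤ) - N)] (N - L)) :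
    (∑' K : ℕ,
      qPochs q [b / t, c / t, d₁ / t, d₂ / t, σ * q, ε, φ, q ^ (-(N : ℤ))] K /
        qPochs q [q, 1 / t, q / e, q / f, σ * q / β, σ * q / γ, σ * q / δ₁, σ * q / δ₂] K *
      q ^ K *
      vwpW q (t * q ^ (-(K : ℤ)))
        [b, c, d₁, d₂, e * q ^ (-(K : ℤ)), f * q ^ (-(K : ℤ)), q ^ (-(K : ℤ))]
        (t ^ 3 * q ^ 3 / (b * c * d₁ * d₂ * e * f)) *
      vwpW q (σ * q ^ K)
        [β, γ, δ₁, δ₂, ε * q ^ K, φ * q ^ K, q ^ ((K : ℤ) - N)]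
        (σ ^ 3 * q ^ (N + 3) / (β * γ * δ₁ * δ₂ * ε * φ))) =
    φ ^ N *
      (qPochs q [σ * q / (δ₁ * φ), σ * q / (δ₂ * φ), ε, σ * q / (γ * φ), σ * q,
          σ * q / (β * φ)] N /
        qPochs q [σ * q / δ₁, σ * q / δ₂, ε / φ, σ * q / γ, σ * q / φ, σ * q / β] N) *
      ∑' L : ℕ,
        qPochs q [t * q / (c * f), t * q / (b * f), t * q / (d₁ * f), t * q / (d₂ * f),
            q ^ (1 - (N : ℤ)) * φ / ε, q ^ (-(N : ℤ)) * φ / σ, φ, q ^ (-(N : ℤ))] L /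
          qPochs q [q, e / f, t * q / f, q / f, q ^ (-(N : ℤ)) * γ * φ / σ,
            q ^ (-(N : ℤ)) * β * φ / σ, q ^ (-(N : ℤ)) * δ₁ * φ / σ,
            q ^ (-(N : ℤ)) * δ₂ * φ / σ] L *
        q ^ L *
        vwpW q (q ^ (-(L : ℤ)) * f / e)
          [t * q / (c * e), t * q / (b * e), t * q / (d₁ * e), t * q / (d₂ * e),
            f * q ^ (-(L : ℤ)) / t, f * q ^ (-(L : ℤ)), q ^ (-(L : ℤ))]
          (b * c * d₁ * d₂ * e * f * q ^ (-1 : ℤ) / t ^ 3) *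
        vwpW q (q ^ ((L : ℤ) - N) * φ / ε)
          [σ * q / (γ * ε), σ * q / (β * ε), σ * q / (δ₁ * ε), σ * q / (δ₂ * ε),
            q ^ (-(N : ℤ) + L) * φ / σ, q ^ L * φ, q ^ ((L : ℤ) - N)]
          (β * γ * δ₁ * δ₂ * ε * φ * q ^ (-(N : ℤ) - 1) / σ ^ 3) := by
  have hq : q ≠ 0 := norm_pos_iff.mp hq0
  have hQ : q ^ N ≠ 0 := pow_ne_zero N hq
  have hprod : b * c * d₁ * d₂ * e * f * (β * γ * δ₁ * δ₂ * ε * φ) ≠ 0 := by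
    rw [← hbal]
    exact mul_ne_zero (mul_ne_zero (pow_ne_zero _ ht) (pow_ne_zero _ hσ)) (pow_ne_zero _ hq)
  simp only [mul_ne_zero_iff] at hprod
  obtain ⟨⟨⟨⟨⟨⟨hb, hc⟩, hd₁⟩, hd₂⟩, he⟩, hf⟩, ⟨⟨⟨⟨hβ, hγ⟩, hδ₁⟩, hδ₂⟩, hε⟩, hφ⟩ := hprod
  have zN : q ^ (-(N : ℤ)) = 1 / q ^ N := by rw [zpow_neg, zpow_natCast, one_div]
  have zN1 : q ^ (1 - (N : ℤ)) = q / q ^ N := by rw [zpow_sub₀ hq, zpow_natCast, zpow_one]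
  have hs0 : q ^ (-(N : ℤ)) * q ^ N = 1 := by rw [zN]; field_simp
  -- regularity of the parameters
  have pL := qPochs_ne_zero_iff.mp hL
  have pP := qPochs_ne_zero_iff.mp hP
  have pR := qPochs_ne_zero_iff.mp hR
  have pL₁ := qPochs_ne_zero_iff.mp (hL₁ N le_rfl).2
  have pL₂ := qPochs_ne_zero_iff.mp (hL₂ 0 (Nat.zero_le N)).2
  have pR₁ := qPochs_ne_zero_iff.mp (hR₁ N le_rfl).2
  have pR₂ := qPochs_ne_zero_iff.mp (hR₂ 0 (Nat.zero_le N)).2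
  simp only [List.map_cons, List.map_nil, List.mem_cons, List.not_mem_nil, or_false,
    forall_eq_or_imp, forall_eq, pow_zero, mul_one, Nat.cast_zero, add_zero, zero_sub,
    Nat.sub_zero, one_mul, zN] at pL pP pR pL₁ pL₂ pR₁ pR₂
  have nt : qPoch q (t * q) N ≠ 0 := by
    convert pL₁.2.2.2.2.2.2 using 2; field_simp
  have ntf : qPoch q (t * q / f) N ≠ 0 := pR.2.1
  have nte : qPoch q (t * q / e) N ≠ 0 := by
    convert pL₁.2.2.2.2.1 using 2; field_simp
  have nfe : qPoch q (f / e * q) N ≠ 0 := by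
    convert pR₁.2.2.2.2.2.2 using 2; field_simp
  have nσ : qPoch q (σ * q ^ N * q) N ≠ 0 := by
    convert pL₂.2.2.2.2.2.2 using 2; field_simp
  have nφε : qPoch q (φ * q ^ N / (ε * q ^ N) * q) N ≠ 0 := by
    convert pR₂.2.2.2.2.2.2 using 2; field_simp
  have nσε : qPoch q (σ * q / ε) N ≠ 0 := pL₂.2.2.2.2.1
  have nσφ : qPoch q (σ * q / φ) N ≠ 0 := pL₂.2.2.2.2.2.1
  have nε : qPoch q (q / (ε * q ^ N)) N ≠ 0 := by
    convert pR₂.2.2.2.2.2.1 using 2; field_simp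
  have st : Separated q t N :=
    separated_of_ne hq (fun K hK => ne_pow_of_one_sub_ne_zero hq (hL₁ K hK).1) nt
  have sfe : Separated q (f / e) N :=
    separated_of_ne hq (fun K hK => ne_pow_of_one_sub_ne_zero hq (by
      convert (hR₁ K hK).1 using 2; ring)) nfe
  have sσ : Separated q (σ * q ^ N) N := by
    refine separated_of_ne hq (fun K hK h => ?_) nσ
    obtain ⟨M, rfl⟩ := Nat.exists_eq_add_of_le' hK
    apply (hL₂ M (by omega)).1
    rw [pow_add] at h
    have := mul_right_cancel₀ (pow_ne_zero K hq) (show σ * q ^ M * q ^ K = 1 * q ^ K by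
      rw [one_mul]; linear_combination h)
    rw [this, sub_self]
  have sφε : Separated q (φ * q ^ N / (ε * q ^ N)) N := by
    refine separated_of_ne hq (fun K hK h => ?_) nφε
    obtain ⟨M, rfl⟩ := Nat.exists_eq_add_of_le' hK
    apply (hR₂ M (by omega)).1
    rw [mul_div_mul_right _ _ hQ] at h
    rw [mul_div_assoc, h, sub_eq_zero, ← zpow_natCast, ← zpow_add₀ hq]
    push_cast
    rw [show (M : ℤ) - (M + K) + K = 0 by ring, zpow_zero]
  have ht1 : 1 - 1 / t ≠ 0 := one_sub_one_div_ne_zero (by simpa using st 0 0 (Nat.zero_le N))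
  have hef1 : 1 - e / f ≠ 0 := by
    rw [← one_div_div]
    exact one_sub_one_div_ne_zero (by simpa using sfe 0 0 (Nat.zero_le N))
  have hσ1 : 1 - 1 / (σ * q ^ N) ≠ 0 :=
    one_sub_one_div_ne_zero (by simpa using sσ 0 0 (Nat.zero_le N))
  have hεφ1 : 1 - ε * q ^ N / (φ * q ^ N) ≠ 0 := by
    rw [← one_div_div]
    exact one_sub_one_div_ne_zero (by
      simpa only [pow_zero, mul_one] using sφε 0 0 (Nat.zero_le N))
  have hσN : σ * q ^ N ≠ 0 := mul_ne_zero hσ hQ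
  have hεN : ε * q ^ N ≠ 0 := mul_ne_zero hε hQ
  have hφN : φ * q ^ N ≠ 0 := mul_ne_zero hφ hQ
  -- the two transformations
  obtain ⟨B, hB⟩ : ∃ B, B = b * c * d₁ * d₂ * e * f / (t ^ 3 * q ^ 2) := ⟨_, rfl⟩
  have hB0 : B ≠ 0 := by rw [hB]; positivity
  -- The balancing condition: the constant of the second family is 1/B. Its parameters carry q^N
  -- because σ q^K = (σ q^N) q^(-(N-K)), and likewise for ε and φ.
  have hB' : 1 / B = β * γ * δ₁ * δ₂ * (ε * q ^ N) * (φ * q ^ N) / ((σ * q ^ N) ^ 3 * q ^ 2) := by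
    rw [hB, one_div_div, div_eq_div_iff (by positivity) (by positivity)]
    linear_combination q ^ N * q ^ N * hbal
  have hv : σ ^ 3 * q ^ (N + 3) / (β * γ * δ₁ * δ₂ * ε * φ) = q * B := by
    rw [hB, mul_div_assoc', div_eq_div_iff (by positivity) (by positivity)]
    linear_combination q * hbal
  have h22 := invShifts_one_div_qPoch pL.2.2.1
  have h22' := invShifts_revPoch hq hφ N
  set T := eulerSum q t b c d₁ d₂ e f (fun m => 1 / qPoch q (q / f) m) with hT
  set U := eulerSum q (σ * q ^ N) β γ δ₁ δ₂ (ε * q ^ N) (φ * q ^ N) (revPoch q φ N) with hU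
  have sum_eq := sum_antidiagonal_euler hq1 hB0 (F := fun n => T n 0) (G := fun n => U n 0)
    (F' := fun n => T 0 n) (G' := fun n => U 0 n) (N := N)
    (fun n hn => eulerSum_transformation hq hq1 ht hb hc hd₁ hd₂ he hf st sfe nte ntf pL.2.1 h22
      hn hB)
    (fun n hn => eulerSum_transformation hq hq1 hσN hβ hγ hδ₁ hδ₂ hεN hφN sσ sφε
      (by convert nσε using 2; field_simp) (by convert nσφ using 2; field_simp) nε h22' hn hB')
  have zKN : ∀ {K M : ℕ}, K + M = N → q ^ ((K : ℤ) - N) * q ^ M = 1 := by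
    rintro K M rfl
    rw [← zpow_natCast q M, ← zpow_add₀ hq]
    push_cast
    rw [show (K : ℤ) - (K + M) + M = 0 by ring, zpow_zero]
  have zKN' : ∀ K : ℕ, q ^ N * q ^ ((K : ℤ) - N) = q ^ K := fun K => by
    rw [zpow_sub₀ hq, zpow_natCast, zpow_natCast, mul_div_cancel₀ _ hQ]
  have zK : ∀ K : ℕ, q ^ (-(K : ℤ)) * q ^ K = 1 := fun K => by
    rw [zpow_neg, zpow_natCast, inv_mul_cancel₀ (pow_ne_zero K hq)]
  have nσN : qPoch q (1 / (σ * q ^ N)) N ≠ 0 := by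
    refine Finset.prod_ne_zero_iff.mpr fun j hj h => ?_
    have hj := Finset.mem_range.mp hj
    refine sσ 0 j (by omega) ?_
    field_simp at h
    rw [pow_zero, mul_one]
    linear_combination h
  set C₁ := qPochs q [σ * q, ε, q ^ (-(N : ℤ))] N /
    qPochs q [σ * q / β, σ * q / γ, σ * q / δ₁, σ * q / δ₂] N with hC₁
  set C₂ := qPochs q [q ^ (1 - (N : ℤ)) * φ / ε, q ^ (-(N : ℤ)) * φ / σ, q ^ (-(N : ℤ))] N /
    qPochs q [q ^ (-(N : ℤ)) * γ * φ / σ, q ^ (-(N : ℤ)) * β * φ / σ,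
      q ^ (-(N : ℤ)) * δ₁ * φ / σ, q ^ (-(N : ℤ)) * δ₂ * φ / σ] N with hC₂
  have hleft : ∀ k ∈ Finset.HasAntidiagonal.antidiagonal N,
      qPochs q [b / t, c / t, d₁ / t, d₂ / t, σ * q, ε, φ, q ^ (-(N : ℤ))] k.1 /
        qPochs q [q, 1 / t, q / e, q / f, σ * q / β, σ * q / γ, σ * q / δ₁, σ * q / δ₂] k.1 *
      q ^ k.1 *
      vwpW q (t * q ^ (-(k.1 : ℤ)))
        [b, c, d₁, d₂, e * q ^ (-(k.1 : ℤ)), f * q ^ (-(k.1 : ℤ)), q ^ (-(k.1 : ℤ))]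
        (t ^ 3 * q ^ 3 / (b * c * d₁ * d₂ * e * f)) *
      vwpW q (σ * q ^ k.1)
        [β, γ, δ₁, δ₂, ε * q ^ k.1, φ * q ^ k.1, q ^ ((k.1 : ℤ) - N)]
        (σ ^ 3 * q ^ (N + 3) / (β * γ * δ₁ * δ₂ * ε * φ)) =
      C₁ * q ^ N * (T k.1 0 * (B ^ k.2 * U k.2 0)) := by
    rintro ⟨K, M⟩ hk
    have hk : K + M = N := by simpa using hk
    have hK : K ≤ N := by omega
    have hM : M ≤ N := by omega
    have eT := left_series_eq hq hq1 ht hb hc hd₁ hd₂ he hf (zK K) (h22.mono hK)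
      (qPoch_ne_zero_of_le pL.1 hK) (qPoch_ne_zero_of_le pL.2.1 hK) (hL₁ K hK) hef1
    have e1 : ∀ x, x * q ^ N * q ^ ((K : ℤ) - N) = x * q ^ K := fun x => by
      rw [mul_assoc, zKN']
    have e2 : (σ * q ^ N) ^ 3 * q ^ 3 / (β * γ * δ₁ * δ₂ * (ε * q ^ N) * (φ * q ^ N)) =
        σ ^ 3 * q ^ (N + 3) / (β * γ * δ₁ * δ₂ * ε * φ) := by
      rw [pow_add]; field_simp
    have eU := left_series_eq hq hq1 hσN hβ hγ hδ₁ hδ₂ hεN hφN (zKN hk) (h22'.mono hM)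
      (qPoch_ne_zero_of_le nσN hM) (qPoch_ne_zero_of_le nε hM)
      (by rw [e1, e1, e1]; have := hL₂ K hK; rwa [show N - K = M by omega] at this) hεφ1
    rw [e1, e1, e1, e2] at eU
    have rev := qPochs_reversal (A₁ := σ * q) (A₂ := ε) (P₁ := σ * q / β) (P₂ := σ * q / γ)
      (P₃ := σ * q / δ₁) (P₄ := σ * q / δ₂) (A₁' := 1 / (σ * q ^ N)) (A₂' := q / (ε * q ^ N))
      (P₁' := β / (σ * q ^ N)) (P₂' := γ / (σ * q ^ N)) (P₃' := δ₁ / (σ * q ^ N))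
      (P₄' := δ₂ / (σ * q ^ N)) hq hq1 hφ hk hs0 (by field_simp) (by field_simp) (by field_simp)
      (by field_simp) (by field_simp) (by field_simp) (qPoch_ne_zero_of_le nσN hM)
      (qPoch_ne_zero_of_le nε hM) (qPochs_ne_zero_iff.mpr (by simpa using pL.2.2.2))
    -- Reversal produces (qB)^M: B^M is the weight in the convolution, and q^M completes q^K to the
    -- constant q^N.
    have eP : σ * q / β * (σ * q / γ) * (σ * q / δ₁) * (σ * q / δ₂) /
        (σ * q * ε * φ * q ^ (-(N : ℤ))) = q * B := by
      rw [← hv, zN]; field_simp; ring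
    rw [eP, ← hC₁] at rev
    trans C₁ * (q ^ K * q ^ M) * (T K 0 * (B ^ M * U M 0))
    swap
    · rw [← pow_add, hk]
    rw [hT, hU, ← eT, ← eU]
    trans qPochs q [b / t, c / t, d₁ / t, d₂ / t] K / qPochs q [q, 1 / t, q / e] K *
      (1 / qPoch q (q / f) K) * (qPochs q [σ * q, ε, φ, q ^ (-(N : ℤ))] K /
        qPochs q [σ * q / β, σ * q / γ, σ * q / δ₁, σ * q / δ₂] K) * q ^ K *
      vwpW q (t * q ^ (-(K : ℤ)))
        [b, c, d₁, d₂, e * q ^ (-(K : ℤ)), f * q ^ (-(K : ℤ)), q ^ (-(K : ℤ))]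
        (t ^ 3 * q ^ 3 / (b * c * d₁ * d₂ * e * f)) *
      vwpW q (σ * q ^ K)
        [β, γ, δ₁, δ₂, ε * q ^ K, φ * q ^ K, q ^ ((K : ℤ) - N)]
        (σ ^ 3 * q ^ (N + 3) / (β * γ * δ₁ * δ₂ * ε * φ))
    · congr 3
      simp only [qPochs_cons, qPochs_nil, mul_one]
      ring
    · rw [rev, mul_pow]
      ring
  have hright : ∀ l ∈ Finset.HasAntidiagonal.antidiagonal N,
      qPochs q [t * q / (c * f), t * q / (b * f), t * q / (d₁ * f), t * q / (d₂ * f),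
            q ^ (1 - (N : ℤ)) * φ / ε, q ^ (-(N : ℤ)) * φ / σ, φ, q ^ (-(N : ℤ))] l.1 /
          qPochs q [q, e / f, t * q / f, q / f, q ^ (-(N : ℤ)) * γ * φ / σ,
            q ^ (-(N : ℤ)) * β * φ / σ, q ^ (-(N : ℤ)) * δ₁ * φ / σ,
            q ^ (-(N : ℤ)) * δ₂ * φ / σ] l.1 *
        q ^ l.1 *
        vwpW q (q ^ (-(l.1 : ℤ)) * f / e)
          [t * q / (c * e), t * q / (b * e), t * q / (d₁ * e), t * q / (d₂ * e),
            f * q ^ (-(l.1 : ℤ)) / t, f * q ^ (-(l.1 : ℤ)), q ^ (-(l.1 : ℤ))]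
          (b * c * d₁ * d₂ * e * f * q ^ (-1 : ℤ) / t ^ 3) *
        vwpW q (q ^ ((l.1 : ℤ) - N) * φ / ε)
          [σ * q / (γ * ε), σ * q / (β * ε), σ * q / (δ₁ * ε), σ * q / (δ₂ * ε),
            q ^ (-(N : ℤ) + l.1) * φ / σ, q ^ l.1 * φ, q ^ ((l.1 : ℤ) - N)]
          (β * γ * δ₁ * δ₂ * ε * φ * q ^ (-(N : ℤ) - 1) / σ ^ 3) =
      C₂ * q ^ N / B ^ N * (B ^ l.1 * T 0 l.1 * U 0 l.2) := by
    rintro ⟨L, M⟩ hl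
    have hl : L + M = N := by simpa using hl
    have hLN : L ≤ N := by omega
    have hM : M ≤ N := by omega
    have eT := right_series_eq hq hq1 ht hb hc hd₁ hd₂ he hf (zK L) (h22.mono hLN)
      (qPoch_ne_zero_of_le pR.1 hLN) (qPoch_ne_zero_of_le pR.2.1 hLN) (hR₁ L hLN) ht1
    have e1 : ∀ x, σ * q ^ N * q / (x * (ε * q ^ N)) = σ * q / (x * ε) := fun x => by field_simp
    have e2 : ∀ x, σ * q ^ N * q / (x * (φ * q ^ N)) = σ * q / (x * φ) := fun x => by field_simp
    have e3 : φ * q ^ N * q ^ ((L : ℤ) - N) = q ^ L * φ := by rw [mul_assoc, zKN', mul_comm]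
    have e4 : φ * q ^ N * q ^ ((L : ℤ) - N) / (σ * q ^ N) = q ^ (-(N : ℤ) + L) * φ / σ := by
      rw [neg_add_eq_sub]; field_simp
    have e5 : q ^ ((L : ℤ) - N) * (φ * q ^ N) / (ε * q ^ N) = q ^ ((L : ℤ) - N) * φ / ε := by
      field_simp
    have e6 : β * γ * δ₁ * δ₂ * (ε * q ^ N) * (φ * q ^ N) * q ^ (-1 : ℤ) / (σ * q ^ N) ^ 3 =
        β * γ * δ₁ * δ₂ * ε * φ * q ^ (-(N : ℤ) - 1) / σ ^ 3 := by
      rw [sub_eq_add_neg, zpow_add₀ hq, zN]; field_simp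
    have e7 : ε * q ^ N / (φ * q ^ N) = ε / φ := mul_div_mul_right _ _ hQ
    have e8 : σ * q ^ N * q / (φ * q ^ N) = σ * q / φ := by field_simp
    have eU := right_series_eq (b := β) (c := γ) hq hq1 hσN hβ hγ hδ₁ hδ₂ hεN hφN (zKN hl)
      (h22'.mono hM)
      (by rw [e7]; exact qPoch_ne_zero_of_le pP.2.2.1 hM)
      (by rw [e8]; exact qPoch_ne_zero_of_le nσφ hM)
      (by
        rw [e1, e1, e1, e1, e4, e3, e5]
        have := hR₂ L hLN
        rwa [show N - L = M by omega] at this) hσ1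
    rw [e1, e1, e1, e1, e2, e2, e2, e2, e4, e3, e5, e6, e7, e8] at eU
    have rev := qPochs_reversal (A₁ := q ^ (1 - (N : ℤ)) * φ / ε) (A₂ := q ^ (-(N : ℤ)) * φ / σ)
      (P₁ := q ^ (-(N : ℤ)) * γ * φ / σ) (P₂ := q ^ (-(N : ℤ)) * β * φ / σ)
      (P₃ := q ^ (-(N : ℤ)) * δ₁ * φ / σ) (P₄ := q ^ (-(N : ℤ)) * δ₂ * φ / σ)
      (A₁' := ε / φ) (A₂' := σ * q / φ)
      (P₁' := σ * q / (γ * φ)) (P₂' := σ * q / (β * φ)) (P₃' := σ * q / (δ₁ * φ))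
      (P₄' := σ * q / (δ₂ * φ)) hq hq1 hφ hl hs0 (by rw [zN1]; field_simp)
      (by rw [zN]; field_simp) (by rw [zN]; field_simp) (by rw [zN]; field_simp)
      (by rw [zN]; field_simp) (by rw [zN]; field_simp) (qPoch_ne_zero_of_le pP.2.2.1 hM)
      (qPoch_ne_zero_of_le nσφ hM)
      (qPochs_ne_zero_iff.mpr (by simpa [zN] using pR.2.2.2))
    have eP : q ^ (-(N : ℤ)) * γ * φ / σ * (q ^ (-(N : ℤ)) * β * φ / σ) *
        (q ^ (-(N : ℤ)) * δ₁ * φ / σ) * (q ^ (-(N : ℤ)) * δ₂ * φ / σ) /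
        (q ^ (1 - (N : ℤ)) * φ / ε * (q ^ (-(N : ℤ)) * φ / σ) * φ * q ^ (-(N : ℤ))) =
        q / B := by
      rw [← mul_one_div q B, hB', zN1, zN]; field_simp
    rw [eP, ← hC₂] at rev
    have hBL : q ^ N / B ^ N * B ^ L = q ^ L * (q / B) ^ M := by
      rw [← hl, pow_add, pow_add, div_pow]; field_simp
    trans C₂ * (q ^ N / B ^ N * B ^ L) * (T 0 L * U 0 M)
    · rw [hBL, hT, hU, ← eT, ← eU]
      trans qPochs q [t * q / (c * f), t * q / (b * f), t * q / (d₁ * f), t * q / (d₂ * f)] L /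
          qPochs q [q, e / f, t * q / f] L * (1 / qPoch q (q / f) L) *
        (qPochs q [q ^ (1 - (N : ℤ)) * φ / ε, q ^ (-(N : ℤ)) * φ / σ, φ, q ^ (-(N : ℤ))] L /
          qPochs q [q ^ (-(N : ℤ)) * γ * φ / σ, q ^ (-(N : ℤ)) * β * φ / σ,
            q ^ (-(N : ℤ)) * δ₁ * φ / σ, q ^ (-(N : ℤ)) * δ₂ * φ / σ] L) *
        q ^ L *
        vwpW q (q ^ (-(L : ℤ)) * f / e)
          [t * q / (c * e), t * q / (b * e), t * q / (d₁ * e), t * q / (d₂ * e),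
            f * q ^ (-(L : ℤ)) / t, f * q ^ (-(L : ℤ)), q ^ (-(L : ℤ))]
          (b * c * d₁ * d₂ * e * f * q ^ (-1 : ℤ) / t ^ 3) *
        vwpW q (q ^ ((L : ℤ) - N) * φ / ε)
          [σ * q / (γ * ε), σ * q / (β * ε), σ * q / (δ₁ * ε), σ * q / (δ₂ * ε),
            q ^ (-(N : ℤ) + L) * φ / σ, q ^ L * φ, q ^ ((L : ℤ) - N)]
          (β * γ * δ₁ * δ₂ * ε * φ * q ^ (-(N : ℤ) - 1) / σ ^ 3)
      · congr 3
        simp only [qPochs_cons, qPochs_nil, mul_one]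
        ring
      · rw [rev]
        ring
    · ring
  have hvanish : ∀ (as : List ℂ) {k : ℕ}, N < k → q ^ (-(N : ℤ)) ∈ as → qPochs q as k = 0 :=
    fun as k hk h => qPochs_eq_zero h (qPoch_eq_zero_of_lt hs0 hk)
  rw [tsum_eq_sum_antidiagonal (N := N) fun k hk => by rw [hvanish _ hk (by simp)]; simp,
    tsum_eq_sum_antidiagonal (N := N) fun k hk => by rw [hvanish _ hk (by simp)]; simp,
    Finset.sum_congr rfl hleft, Finset.sum_congr rfl hright, ← Finset.mul_sum, ← Finset.mul_sum,
    sum_eq, ← mul_assoc]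
  congr 1
  -- the prefactors
  have f1 := qPoch_eq_full_reversal (x := q ^ (1 - (N : ℤ)) * φ / ε) (y := ε / φ) (N := N) hq
    (by rw [zN1]; field_simp)
  have f2 := qPoch_eq_full_reversal (x := q ^ (-(N : ℤ)) * φ / σ) (y := σ * q / φ) (N := N) hq
    (by rw [zN]; field_simp)
  have fx : ∀ x, x ≠ 0 → qPoch q (q ^ (-(N : ℤ)) * x * φ / σ) N =
      qPoch q (σ * q / (x * φ)) N * (q ^ (-(N : ℤ)) * x * φ / σ) ^ N * reversalFactor q 0 N :=
    fun x hx => qPoch_eq_full_reversal hq (by rw [zN]; field_simp)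
  have fne : ∀ x, x ≠ 0 → qPoch q (1 / q ^ N * x * φ / σ) N ≠ 0 →
      qPoch q (σ * q / (x * φ)) N ≠ 0 := fun x hx h => by
    rw [← zN, fx x hx] at h
    exact left_ne_zero_of_mul (left_ne_zero_of_mul h)
  have gβ := fne β hβ pR.2.2.2.2.1
  have gγ := fne γ hγ pR.2.2.2.1
  have gδ₁ := fne δ₁ hδ₁ pR.2.2.2.2.2.1
  have gδ₂ := fne δ₂ hδ₂ pR.2.2.2.2.2.2
  have nE := reversalFactor_ne_zero hq 0 N
  have hE := reversalFactor_zero_sq q N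
  obtain ⟨p1, p2, p3, p4, p5, p6⟩ := pP
  simp only [hC₁, hC₂, qPochs_cons, qPochs_nil, mul_one]
  rw [f1, f2, fx β hβ, fx γ hγ, fx δ₁ hδ₁, fx δ₂ hδ₂]
  -- Two numerator and four denominator factorials were reversed, so the square of `reversalFactor q
  -- 0 N` is left over; times q^N it is q^(N²), which the N-th powers supply.
  have hpow : φ ^ N * (q ^ (1 - (N : ℤ)) * φ / ε) ^ N * (q ^ (-(N : ℤ)) * φ / σ) ^ N * q ^ N =
      (q ^ (-(N : ℤ)) * β * φ / σ) ^ N * (q ^ (-(N : ℤ)) * γ * φ / σ) ^ N *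
        (q ^ (-(N : ℤ)) * δ₁ * φ / σ) ^ N * (q ^ (-(N : ℤ)) * δ₂ * φ / σ) ^ N * B ^ N *
        (q ^ N) ^ N := by
    simp only [← mul_pow]
    congr 1
    rw [← one_div_one_div B, hB', zN1, zN]
    field_simp
  rw [← hE] at hpow
  have hpow' : φ ^ N * (q ^ (1 - (N : ℤ)) * φ / ε) ^ N * (q ^ (-(N : ℤ)) * φ / σ) ^ N =
      (q ^ (-(N : ℤ)) * β * φ / σ) ^ N * (q ^ (-(N : ℤ)) * γ * φ / σ) ^ N *
        (q ^ (-(N : ℤ)) * δ₁ * φ / σ) ^ N * (q ^ (-(N : ℤ)) * δ₂ * φ / σ) ^ N * B ^ N *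
        reversalFactor q 0 N ^ 2 := by
    apply mul_right_cancel₀ hQ
    rw [hpow]; ring
  have hz : q ^ (-(N : ℤ)) ≠ 0 := zpow_ne_zero _ hq
  have nx : ∀ x, x ≠ 0 → (q ^ (-(N : ℤ)) * x * φ / σ) ^ N ≠ 0 := fun x hx =>
    pow_ne_zero N (div_ne_zero (mul_ne_zero (mul_ne_zero hz hx) hφ) hσ)
  have xβ := nx β hβ
  have xγ := nx γ hγ
  have xδ₁ := nx δ₁ hδ₁
  have xδ₂ := nx δ₂ hδ₂
  have nB := pow_ne_zero N hB0
  generalize (q ^ (1 - (N : ℤ)) * φ / ε) ^ N = y1 at *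
  generalize (q ^ (-(N : ℤ)) * φ / σ) ^ N = y2 at *
  generalize (q ^ (-(N : ℤ)) * β * φ / σ) ^ N = y3 at *
  generalize (q ^ (-(N : ℤ)) * γ * φ / σ) ^ N = y4 at *
  generalize (q ^ (-(N : ℤ)) * δ₁ * φ / σ) ^ N = y5 at *
  generalize (q ^ (-(N : ℤ)) * δ₂ * φ / σ) ^ N = y6 at *
  generalize reversalFactor q 0 N = E at *
  generalize φ ^ N = y7 at *
  generalize B ^ N = y8 at *
  generalize q ^ N = y9 at *
  generalize qPoch q (σ * q / (β * φ)) N = w1 at *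
  generalize qPoch q (σ * q / (γ * φ)) N = w2 at *
  generalize qPoch q (σ * q / (δ₁ * φ)) N = w3 at *
  generalize qPoch q (σ * q / (δ₂ * φ)) N = w4 at *
  generalize qPoch q (σ * q / β) N = w5 at *
  generalize qPoch q (σ * q / γ) N = w6 at *
  generalize qPoch q (σ * q / δ₁) N = w7 at *
  generalize qPoch q (σ * q / δ₂) N = w8 at *
  generalize qPoch q (σ * q / φ) N = w9 at *
  generalize qPoch q (ε / φ) N = w10 at *
  generalize qPoch q (σ * q) N = w11 at *
  generalize qPoch q ε N = w12 at *
  generalize qPoch q (q ^ (-(N : ℤ))) N = w13 at *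
  field_simp
  linear_combination (-w11 * w12 * w13) * hpow'
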